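/- Let $A$ and $B$ be unital C*-algebras. For $n\ge 1$ let $GL_n(A)$ and $U_n(A)$ be the groups of invertible and of unitary elements of $M_n(A)$, and let $GL_\infty(A)=\varinjlim GL_n(A)$ and $U_\infty(A)=\varinjlim U_n(A)$ along the maps $x\mapsto x\oplus 1$, with the inductive limit topologies. For a group $G$ with a topology let $DG$ be its derived subgroup, generated by the commutators $ghg^{-1}h^{-1}$, and let $CG=\overline{DG}$ be the closure of $DG$ in $G$. Put $$\overline{K}_1^{\mathrm{alg}}(A)=GL_\infty(A)/CGL_\infty(A),\qquad \overline{K}_1^{\mathrm{alg},u}(A)=U_\infty(A)/CU_\infty(A),$$ and let $T(A)$ be the set of tracial states of $A$. A unital $*$-homomorphism $\phi:A\to B$ induces, by applying $\phi$ to matrix entries, group homomorphisms $\overline{K}_1^{\mathrm{alg}}(\phi):\overline{K}_1^{\mathrm{alg}}(A)\to\overline{K}_1^{\mathrm{alg}}(B)$ and $\overline{K}_1^{\mathrm{alg},u}(\phi):\overline{K}_1^{\mathrm{alg},u}(A)\to\overline{K}_1^{\mathrm{alg},u}(B)$, and by composition the map $T(\phi):T(B)\to T(A)$, $\tau\mapsto\tau\circ\phi$.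 Let $\phi,\psi:A\to B$ be unital $*$-homomorphisms. The following are equivalent: 1. $\overline{K}_1^{\mathrm{alg},u}(\phi)=\overline{K}_1^{\mathrm{alg},u}(\psi)$ and $T(\phi)=T(\psi)$; 2. $\overline{K}_1^{\mathrm{alg}}(\phi)=\overline{K}_1^{\mathrm{alg}}(\psi)$. -/

import Mathlib

open scoped ComplexOrder

namespace HausdorffK1

/-! ### The Hausdorffized abelianization of a group with a topology

The group is only assumed to have separately continuous multiplication and continuous inversion,
because `GL_∞(A)` and `U_∞(A)` are not topological groups in general. -/

section Abelianization

variable (G : Type*) [Group G] [TopologicalSpace G] [SeparatelyContinuousMul G] [ContinuousInv G]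

/-- `CG`: the closure of the derived subgroup `DG`. -/
def closedCommutator : Subgroup G where
  carrier := closure (commutator G : Set G)
  one_mem' := subset_closure (one_mem (commutator G))
  mul_mem' := by
    have key : ∀ a ∈ commutator G, ∀ b ∈ closure (commutator G : Set G),
        a * b ∈ closure (commutator G : Set G) := fun a ha b hb =>
      map_mem_closure (SeparatelyContinuousMul.continuous_const_mul (a := a)) hb
        fun c hc => mul_mem ha hc
    intro a b ha hb
    rw [← closure_closure (s := (commutator G : Set G))]
    exact map_mem_closure (f := fun c => c * b)
      (SeparatelyContinuousMul.continuous_mul_const (a := b)) ha fun c hc => key c hc b hb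
  inv_mem' := fun {a} ha => map_mem_closure continuous_inv ha fun c hc => inv_mem hc

instance closedCommutator_normal : (closedCommutator G).Normal where
  conj_mem n hn g := by
    have hc : Continuous fun x : G => g * x * g⁻¹ :=
      (SeparatelyContinuousMul.continuous_mul_const (a := g⁻¹)).comp
        (SeparatelyContinuousMul.continuous_const_mul (a := g))
    exact map_mem_closure (f := fun x => g * x * g⁻¹) hc hn fun m hm =>
      Subgroup.Normal.conj_mem (inferInstance : (commutator G).Normal) m hm g

/-- `G / CG`, a group with the quotient topology. -/
abbrev HausdorffAbelianization : Type _ := G ⧸ closedCommutator G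

variable {G}
variable {H : Type*} [Group H] [TopologicalSpace H] [SeparatelyContinuousMul H] [ContinuousInv H]

theorem closedCommutator_le_comap (f : G →* H) (hf : Continuous f) :
    closedCommutator G ≤ (closedCommutator H).comap f := fun x hx => by
  have hle : commutator G ≤ (commutator H).comap f := by
    rw [← Subgroup.map_le_iff_le_comap, commutator_def, commutator_def, Subgroup.map_commutator]
    exact Subgroup.commutator_mono le_top le_top
  exact map_mem_closure hf hx fun y hy => hle hy

/-- The homomorphism `G / CG → H / CH` induced by a continuous homomorphism `G → H`. -/
def HausdorffAbelianization.map (f : G →* H) (hf : Continuous f) :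
    HausdorffAbelianization G →* HausdorffAbelianization H :=
  QuotientGroup.map _ _ f (closedCommutator_le_comap f hf)

end Abelianization

/-! ### Sequential inductive limits of topological groups

`DirectLimit G f` is a quotient of `Σ n, G n`; its quotient topology is the inductive limit
topology (the finest one that makes all maps `G n → DirectLimit G f` continuous). -/

section Limit

variable {G : ℕ → Type*} [∀ n, Group (G n)]
variable (f : ∀ i j, i ≤ j → G i →* G j) [DirectedSystem G (f · · ·)]

theorem mk_mul_mk (i j : ℕ) (x : G i) (y : G j) :
    (⟦⟨i, x⟩⟧ : DirectLimit G f) * ⟦⟨j, y⟩⟧ =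
      ⟦⟨max i j, f i _ (le_max_left i j) x * f j _ (le_max_right i j) y⟩⟧ := by
  rw [← DirectLimit.mul_def, DirectLimit.mk_apply, DirectLimit.mk_apply]

variable [∀ n, TopologicalSpace (G n)]

theorem continuous_mk (n : ℕ) :
    Continuous fun x : G n => (⟦⟨n, x⟩⟧ : DirectLimit G f) :=
  continuous_quotient_mk'.comp continuous_sigmaMk

variable {f} in
theorem continuous_of_comp_mk {X : Type*} [TopologicalSpace X] {F : DirectLimit G f → X}
    (hF : ∀ n, Continuous fun x : G n => F ⟦⟨n, x⟩⟧) : Continuous F :=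
  continuous_coinduced_dom.2 (continuous_sigma hF)

theorem separatelyContinuousMul_directLimit [∀ n, IsTopologicalGroup (G n)]
    (hf : ∀ i j h, Continuous (f i j h)) : SeparatelyContinuousMul (DirectLimit G f) where
  continuous_const_mul {a} := by
    induction a using DirectLimit.induction with
    | ih i x =>
      refine continuous_of_comp_mk fun j => ?_
      simp only [mk_mul_mk]
      exact (continuous_mk f _).comp (continuous_const.mul (hf _ _ _))
  continuous_mul_const {a} := by
    induction a using DirectLimit.induction with
    | ih i x =>
      refine continuous_of_comp_mk fun j => ?_
      simp only [mk_mul_mk]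
      exact (continuous_mk f _).comp ((hf _ _ _).mul continuous_const)

theorem continuousInv_directLimit [∀ n, IsTopologicalGroup (G n)] :
    ContinuousInv (DirectLimit G f) where
  continuous_inv := by
    refine continuous_of_comp_mk fun j => ?_
    simp only [DirectLimit.inv_def]
    exact (continuous_mk f _).comp continuous_inv

variable {f} {H : ℕ → Type*} [∀ n, Group (H n)] [∀ n, TopologicalSpace (H n)]
variable {g : ∀ i j, i ≤ j → H i →* H j} [DirectedSystem H (g · · ·)]

/-- The homomorphism of inductive limits induced by a compatible sequence of homomorphisms. -/
noncomputable def limitMap (F : ∀ n, G n →* H n)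
    (hF : ∀ i j h x, g i j h (F i x) = F j (f i j h x)) : DirectLimit G f →* DirectLimit H g :=
  MonoidHom.mk' (DirectLimit.map f g (fun n => F n) hF) fun a b => by
    induction a, b using DirectLimit.induction₂ with
    | ih i x y => simp only [DirectLimit.mul_def, DirectLimit.map_def, map_mul]

theorem continuous_limitMap (F : ∀ n, G n →* H n)
    (hF : ∀ i j h x, g i j h (F i x) = F j (f i j h x)) (hc : ∀ n, Continuous (F n)) :
    Continuous (limitMap F hF) :=
  continuous_of_comp_mk fun n => (continuous_mk g n).comp (hc n)

end Limit

/-! ### Matrices over a unital C⋆-algebra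

`M_n(A)` is `Matrix (Fin n) (Fin n) A` with its conjugate transpose as involution and the topology
of entrywise convergence, which is the topology of the C⋆-norm of `M_n(A)`. -/

section Matrices

variable {A : Type*} [CStarAlgebra A]

/-- The map `M_n(A) → M_m(A)`, `x ↦ x ⊕ 1_{m-n}`, for `n ≤ m`. -/
def pad {n m : ℕ} (h : n ≤ m) : Matrix (Fin n) (Fin n) A →⋆* Matrix (Fin m) (Fin m) A where
  toFun x := Matrix.of fun i j =>
    if hij : (i : ℕ) < n ∧ (j : ℕ) < n then x ⟨i, hij.1⟩ ⟨j, hij.2⟩ else if i = j then 1 else 0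
  map_one' := by
    ext i j
    simp only [Matrix.of_apply, Matrix.one_apply, Fin.ext_iff]
    split_ifs <;> rfl
  map_mul' x y := by
    obtain ⟨d, rfl⟩ := Nat.exists_eq_add_of_le h
    have h1 : ∀ (a : Fin n) (b : Fin d), (a : ℕ) ≠ n + b := fun a b => by omega
    have h2 : ∀ (a : Fin n) (b : Fin d), n + (b : ℕ) ≠ a := fun a b => by omega
    ext i j
    refine Fin.addCases (fun i => ?_) (fun i => ?_) i <;>
      refine Fin.addCases (fun j => ?_) (fun j => ?_) j <;>
      simp [Matrix.mul_apply, Fin.sum_univ_add, Fin.ext_iff, h1, h2]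
    simp [Fin.val_inj]
  map_star' x := by
    ext i j
    by_cases hij : (i : ℕ) < n ∧ (j : ℕ) < n
    · simp [Matrix.star_apply, hij]
    · have hji : ¬ ((j : ℕ) < n ∧ (i : ℕ) < n) := fun h => hij h.symm
      simp only [Matrix.of_apply, Matrix.star_apply, dif_neg hij, dif_neg hji, eq_comm (a := j)]
      split_ifs <;> simp

theorem pad_apply {n m : ℕ} (h : n ≤ m) (x : Matrix (Fin n) (Fin n) A) (i j : Fin m) :
    pad h x i j = if hij : (i : ℕ) < n ∧ (j : ℕ) < n then x ⟨i, hij.1⟩ ⟨j, hij.2⟩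
      else if i = j then 1 else 0 := rfl

theorem pad_self {n : ℕ} (h : n ≤ n) (x : Matrix (Fin n) (Fin n) A) : pad h x = x := by
  ext i j
  simp [pad_apply]

theorem pad_pad {n m k : ℕ} (h : n ≤ m) (h' : m ≤ k) (x : Matrix (Fin n) (Fin n) A) :
    pad h' (pad h x) = pad (h.trans h') x := by
  ext i j
  simp only [pad_apply, Fin.ext_iff]
  split_ifs <;> first | rfl | omega

theorem continuous_pad {n m : ℕ} (h : n ≤ m) :
    Continuous (pad h : Matrix (Fin n) (Fin n) A → Matrix (Fin m) (Fin m) A) := by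
  refine continuous_matrix fun i j => ?_
  simp only [pad_apply]
  split_ifs
  · exact continuous_id.matrix_elem _ _
  · exact continuous_const
  · exact continuous_const

variable {B : Type*} [CStarAlgebra B] (φ : A →⋆ₐ[ℂ] B)

theorem continuous_starAlgHom : Continuous φ :=
  AddMonoidHomClass.continuous_of_bound φ 1 fun a => by
    simpa only [one_mul] using! NonUnitalStarAlgHom.norm_apply_le φ a

/-- The map `M_n(A) → M_n(B)` that applies a unital ⋆-homomorphism `φ : A → B` to each entry. -/
def matrixMap (n : ℕ) : Matrix (Fin n) (Fin n) A →⋆* Matrix (Fin n) (Fin n) B where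
  toFun x := x.map φ
  map_one' := Matrix.map_one φ (map_zero φ) (map_one φ)
  map_mul' x y := Matrix.map_mul
  map_star' x := by
    ext i j
    simp [Matrix.star_apply, map_star]

theorem continuous_matrixMap (n : ℕ) : Continuous (matrixMap φ n) :=
  continuous_id.matrix_map (continuous_starAlgHom φ)

theorem pad_matrixMap {n m : ℕ} (h : n ≤ m) (x : Matrix (Fin n) (Fin n) A) :
    pad h (matrixMap φ n x) = matrixMap φ m (pad h x) := by
  ext i j
  change _ = φ (pad h x i j)
  simp only [pad_apply]
  split_ifs
  · rfl
  · simp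
  · simp

end Matrices

/-! ### The groups `GL_∞(A)` and `U_∞(A)` -/

section Groups

variable (A : Type*) [CStarAlgebra A]

/-- `GL_n(A)`, the invertible elements of `M_n(A)`. -/
abbrev GLn (n : ℕ) : Type _ := (Matrix (Fin n) (Fin n) A)ˣ

/-- `U_n(A)`, the unitary elements of `M_n(A)`. -/
abbrev Un (n : ℕ) : Type _ := unitary (Matrix (Fin n) (Fin n) A)

/-- The connecting map `GL_n(A) → GL_m(A)`, `x ↦ x ⊕ 1_{m-n}`. -/
def padGL (n m : ℕ) (h : n ≤ m) : GLn A n →* GLn A m := Units.map (pad h).toMonoidHom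

/-- The connecting map `U_n(A) → U_m(A)`, `u ↦ u ⊕ 1_{m-n}`. -/
def padU (n m : ℕ) (h : n ≤ m) : Un A n →* Un A m := (Unitary.map (pad h)).toMonoidHom

instance directedSystem_padGL : DirectedSystem (GLn A) (padGL A · · ·) where
  map_self _ _ := Units.ext (pad_self _ _)
  map_map _ _ _ _ _ _ := Units.ext (pad_pad _ _ _)

instance directedSystem_padU : DirectedSystem (Un A) (padU A · · ·) where
  map_self _ _ := Subtype.ext (pad_self _ _)
  map_map _ _ _ _ _ _ := Subtype.ext (pad_pad _ _ _)

theorem continuous_padGL (n m : ℕ) (h : n ≤ m) : Continuous (padGL A n m h) :=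
  (continuous_pad h).units_map _

theorem continuous_padU (n m : ℕ) (h : n ≤ m) : Continuous (padU A n m h) :=
  ((continuous_pad h).comp continuous_subtype_val).subtype_mk _

/-- `GL_∞(A)`, with the inductive limit topology. -/
abbrev GLInf : Type _ := DirectLimit (GLn A) (padGL A)

/-- `U_∞(A)`, with the inductive limit topology. -/
abbrev UInf : Type _ := DirectLimit (Un A) (padU A)

instance : SeparatelyContinuousMul (GLInf A) :=
  separatelyContinuousMul_directLimit _ (continuous_padGL A)

instance : ContinuousInv (GLInf A) := continuousInv_directLimit _

instance : SeparatelyContinuousMul (UInf A) :=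
  separatelyContinuousMul_directLimit _ (continuous_padU A)

instance : ContinuousInv (UInf A) := continuousInv_directLimit _

/-- Hausdorffized algebraic `K₁`: the group `GL_∞(A) / CGL_∞(A)`. -/
abbrev HausdorffK1Alg : Type _ := HausdorffAbelianization (GLInf A)

/-- Hausdorffized unitary algebraic `K₁`: the group `U_∞(A) / CU_∞(A)`. -/
abbrev HausdorffK1AlgU : Type _ := HausdorffAbelianization (UInf A)

end Groups

/-! ### Induced maps -/

section Induced

variable {A B : Type*} [CStarAlgebra A] [CStarAlgebra B] (φ : A →⋆ₐ[ℂ] B)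

/-- `GL_n(φ) : GL_n(A) → GL_n(B)`. -/
def mapGL (n : ℕ) : GLn A n →* GLn B n := Units.map (matrixMap φ n).toMonoidHom

/-- `U_n(φ) : U_n(A) → U_n(B)`. -/
def mapU (n : ℕ) : Un A n →* Un B n := (Unitary.map (matrixMap φ n)).toMonoidHom

/-- `GL_∞(φ) : GL_∞(A) → GL_∞(B)`. -/
noncomputable def mapGLInf : GLInf A →* GLInf B :=
  limitMap (mapGL φ) fun _ _ h x => Units.ext (pad_matrixMap φ h x)

/-- `U_∞(φ) : U_∞(A) → U_∞(B)`. -/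
noncomputable def mapUInf : UInf A →* UInf B :=
  limitMap (mapU φ) fun _ _ h x => Subtype.ext (pad_matrixMap φ h x)

theorem continuous_mapGLInf : Continuous (mapGLInf φ) :=
  continuous_limitMap _ _ fun n => (continuous_matrixMap φ n).units_map _

theorem continuous_mapUInf : Continuous (mapUInf φ) :=
  continuous_limitMap _ _ fun n =>
    ((continuous_matrixMap φ n).comp continuous_subtype_val).subtype_mk _

/-- The map that `φ` induces on Hausdorffized algebraic `K₁`. -/
noncomputable def hausdorffK1AlgMap : HausdorffK1Alg A →* HausdorffK1Alg B :=
  HausdorffAbelianization.map (mapGLInf φ) (continuous_mapGLInf φ)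

/-- The map that `φ` induces on Hausdorffized unitary algebraic `K₁`. -/
noncomputable def hausdorffK1AlgUMap : HausdorffK1AlgU A →* HausdorffK1AlgU B :=
  HausdorffAbelianization.map (mapUInf φ) (continuous_mapUInf φ)

end Induced

/-! ### Tracial states -/

section Traces

/-- `T(A)`: the positive linear functionals `τ` on `A` with `τ 1 = 1` and `τ (a * b) = τ (b * a)`. -/
def tracialStates (A : Type*) [CStarAlgebra A] : Set (WeakDual ℂ A) :=
  {τ | (∀ a : A, 0 ≤ τ (star a * a)) ∧ τ 1 = 1 ∧ ∀ a b : A, τ (a * b) = τ (b * a)}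

variable {A B : Type*} [CStarAlgebra A] [CStarAlgebra B]

/-- `T(φ) : T(B) → T(A)`, `τ ↦ τ ∘ φ`. -/
noncomputable def tracialStatesMap (φ : A →⋆ₐ[ℂ] B) (τ : tracialStates B) : tracialStates A :=
  ⟨StrongDual.toWeakDual ((WeakDual.toStrongDual τ.1).comp
      (⟨φ.toAlgHom.toLinearMap, continuous_starAlgHom φ⟩ : A →L[ℂ] B)), by
    obtain ⟨h0, h1, h2⟩ := τ.2
    refine ⟨fun a => ?_, ?_, fun a b => ?_⟩
    · change 0 ≤ τ.1 (φ (star a * a))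
      rw [map_mul φ, map_star φ]
      exact h0 _
    · change τ.1 (φ 1) = 1
      rw [map_one φ, h1]
    · change τ.1 (φ (a * b)) = τ.1 (φ (b * a))
      rw [map_mul φ, map_mul φ, h2]⟩

theorem tracialStatesMap_apply (φ : A →⋆ₐ[ℂ] B) (τ : tracialStates B) (a : A) :
    (tracialStatesMap φ τ).1 a = τ.1 (φ a) := rfl

end Traces

end HausdorffK1

open scoped ComplexOrder
open Filter Topology NormedSpace Set

namespace HausdorffK1

/-! The polar decomposition x = u exp(s), with u unitary and s = log|x| selfadjoint, separates the
class of x in GL/CGL into a unitary class and an exponential. Two facts about a C⋆-algebra M make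
this work.

Traces control exponentials. Let q be a homomorphism with closed kernel from the invertible or the
unitary group of M to a commutative group. By the Lie product formula, h ↦ q(exp h), or h ↦
q(exp(ih)), is additive on selfadjoint elements. It kills uhu⋆ - h for unitary u, and its kernel is
closed. By Hahn–Banach and a Jordan decomposition of invariant functionals, the closed span of such
differences contains every selfadjoint element on which all positive traces vanish
(`mem_of_forall_trace_eq_zero`). So q(exp h) depends only on the traces of h. If φ and ψ agree on
unitary classes and on traces, they therefore agree on the class of u and on that of exp(s), hence
on that of x.

Unitary part and determinant are homomorphisms. The map x ↦ [u] is multiplicative modulo CU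
(`map_polar_mul`), and x ↦ τ(log x⋆x) turns products into sums for tracial τ (`trace_logAbsSq_mul`).
Both are continuous and compatible with x ↦ x ⊕ 1, so they factor through GL_∞/CGL_∞. The first is a
left inverse of U_∞/CU_∞ → GL_∞/CGL_∞, and the second sends exp(h) to 2τ(h). Agreement on GL classes
thus forces agreement on unitary classes and on traces.

Both multiplicativity statements are proved along the path t ↦ exp(ts)y: the quantity, corrected by
a linear term for the determinant, is locally constant in t. The local computation uses `logTrace`,
the trace of the logarithm near 1, which is additive on products although the logarithm itself is
not. -/

/-- The rational normed algebra structure that the exponential series refers to. -/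
@[reducible] noncomputable def ratNormedAlgebra (M : Type*) [CStarAlgebra M] : NormedAlgebra ℚ M :=
  NormedAlgebra.restrictScalars ℚ ℂ M

attribute [local instance] ratNormedAlgebra

/-! ### The trace of the logarithm near 1. -/

section LogTrace

variable {M : Type*} [CStarAlgebra M]

/-- A bounded linear functional is tracial if it vanishes on commutators. -/
def IsTracial (τ : M →L[ℂ] ℂ) : Prop := ∀ a b : M, τ (a * b) = τ (b * a)

/-- The trace of the principal logarithm, as a power series around `1`. -/
noncomputable def logTrace (τ : M →L[ℂ] ℂ) (g : M) : ℂ :=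
  -∑' n : ℕ, ((n : ℂ) + 1)⁻¹ * τ ((1 - g) ^ (n + 1))

theorem norm_one_le : ‖(1 : M)‖ ≤ 1 := by
  -- The zero algebra has to be admitted, since M_0(B) is one.
  rcases subsingleton_or_nontrivial M with h | h
  · simp [Subsingleton.elim (1 : M) 0]
  · exact CStarRing.norm_one.le

theorem norm_pow_le_pow_norm (x : M) (n : ℕ) : ‖x ^ n‖ ≤ ‖x‖ ^ n := by
  rcases n.eq_zero_or_pos with rfl | h
  · simpa using norm_one_le
  · exact norm_pow_le' x h

/-- The derivative of y^(n+1) at x is the sum of the n+1 terms x^(n-i) v x^i. They all have the same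
trace τ(x^n v), so the factor 1/(n+1) cancels. -/
theorem IsTracial.hasFDerivAt_pow {τ : M →L[ℂ] ℂ} (hτ : IsTracial τ) (n : ℕ) (x : M) :
    HasFDerivAt (fun y : M => ((n : ℂ) + 1)⁻¹ * τ (y ^ (n + 1)))
      (τ.comp (ContinuousLinearMap.mul ℂ M (x ^ n))) x := by
  have h := (τ.hasFDerivAt.comp x (hasFDerivAt_pow' (𝕜 := ℂ) (n + 1) (x := x))).const_mul
    ((n : ℂ) + 1)⁻¹
  refine h.congr_fderiv ?_
  ext v
  have hn : (n : ℂ) + 1 ≠ 0 := Nat.cast_add_one_ne_zero n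
  have key : ∀ i ∈ Finset.range (n + 1), τ (x ^ (n - i) * v * x ^ i) = τ (x ^ n * v) := by
    intro i hi
    rw [hτ, ← mul_assoc, ← pow_add]
    congr 3
    have := Finset.mem_range.1 hi
    omega
  simp only [_root_.smul_apply, ContinuousLinearMap.comp_apply,
    _root_.sum_apply, map_sum, ContinuousLinearMap.mul_apply', smul_eq_mul,
    MulOpposite.smul_eq_mul_unop, MulOpposite.unop_op, ContinuousLinearMap.id_apply,
    Nat.pred_eq_sub_one, Nat.add_sub_cancel]
  rw [Finset.sum_congr rfl key]
  simp only [Finset.sum_const, Finset.card_range, nsmul_eq_mul]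
  push_cast
  field_simp

/-- Termwise differentiation produces the geometric series in 1 - g, whose sum is g⁻¹ = k. Under a
trace the logarithm thus has the derivative v ↦ τ(g⁻¹v), as in the commutative case. -/
theorem IsTracial.hasFDerivAt_logTrace {τ : M →L[ℂ] ℂ} (hτ : IsTracial τ) {g : M}
    (hg : ‖g - 1‖ < 1) (k : M) (hk : k * g = 1) :
    HasFDerivAt (logTrace τ) (τ.comp (ContinuousLinearMap.mul ℂ M k)) g := by
  obtain ⟨r, hr, hr1⟩ := exists_between hg
  have hr0 : 0 < r := (norm_nonneg _).trans_lt hr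
  have hx : 1 - g ∈ Metric.ball (0 : M) r := by
    rwa [mem_ball_zero_iff, ← norm_neg, neg_sub]
  have hbound : ∀ (n : ℕ) (x : M), x ∈ Metric.ball (0 : M) r →
      ‖τ.comp (ContinuousLinearMap.mul ℂ M (x ^ n))‖ ≤ ‖τ‖ * r ^ n := by
    intro n x hx
    refine (ContinuousLinearMap.opNorm_comp_le _ _).trans ?_
    gcongr
    refine (ContinuousLinearMap.opNorm_mul_apply_le ℂ M _).trans ?_
    refine (norm_pow_le_pow_norm x n).trans ?_
    gcongr
    exact (mem_ball_zero_iff.1 hx).le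
  have hsum : Summable fun n : ℕ => ‖τ‖ * r ^ n :=
    (summable_geometric_of_lt_one hr0.le hr1).mul_left _
  have h := hasFDerivAt_tsum_of_isPreconnected (𝕜 := ℂ) hsum Metric.isOpen_ball
    (convex_ball (0 : M) r).isPreconnected (fun n x _ => hτ.hasFDerivAt_pow n x) hbound
    (Metric.mem_ball_self hr0) (by simp) hx
  have hgeo : HasSum (fun n : ℕ => τ.comp (ContinuousLinearMap.mul ℂ M ((1 - g) ^ n)))
      (τ.comp (ContinuousLinearMap.mul ℂ M k)) := by
    have h1 : Summable fun n : ℕ => (1 - g) ^ n :=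
      summable_geometric_of_norm_lt_one
        ((mem_ball_zero_iff.1 hx).trans hr1)
    have h2 : ∑' n : ℕ, (1 - g) ^ n = k := by
      have := geom_series_mul_neg (1 - g) ((mem_ball_zero_iff.1 hx).trans hr1)
      rw [sub_sub_cancel] at this
      have h3 : g * ∑' n : ℕ, (1 - g) ^ n = 1 := by
        have := mul_neg_geom_series (1 - g) ((mem_ball_zero_iff.1 hx).trans hr1)
        rwa [sub_sub_cancel] at this
      exact (left_inv_eq_right_inv hk h3).symm
    have h3 := h1.hasSum
    rw [h2] at h3
    exact h3.mapL ((ContinuousLinearMap.compL ℂ M M ℂ τ).comp (ContinuousLinearMap.mul ℂ M))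
  rw [hgeo.tsum_eq] at h
  have h4 := (h.comp g ((hasFDerivAt_id g).const_sub 1)).neg
  refine h4.congr_fderiv ?_
  ext v
  simp

theorem logTrace_one (τ : M →L[ℂ] ℂ) : logTrace τ 1 = 0 := by
  simp [logTrace]

theorem IsTracial.apply_conj {τ : M →L[ℂ] ℂ} (hτ : IsTracial τ) {k k' : M} (hk : k' * k = 1)
    (g : M) : τ (k * g * k') = τ g := by
  rw [hτ, ← mul_assoc, hk, one_mul]

/-- Each term of the series is conjugation invariant, so no convergence is needed and g may be
arbitrary. -/
theorem IsTracial.logTrace_conj {τ : M →L[ℂ] ℂ} (hτ : IsTracial τ) {k k' : M} (hk : k' * k = 1)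
    (hk' : k * k' = 1) (g : M) : logTrace τ (k * g * k') = logTrace τ g := by
  have h : ∀ n : ℕ, (1 - k * g * k') ^ n = k * (1 - g) ^ n * k' := by
    intro n
    induction n with
    | zero => simp [hk']
    | succ n ih =>
      rw [pow_succ, ih, pow_succ]
      have : 1 - k * g * k' = k * (1 - g) * k' := by
        rw [mul_sub, sub_mul, mul_one, hk']
      rw [this]
      calc _ = k * (1 - g) ^ n * (k' * k) * (1 - g) * k' := by simp only [mul_assoc]
        _ = _ := by rw [hk]; simp only [mul_assoc, one_mul]
  simp only [logTrace, h, hτ.apply_conj hk]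

/-- The logarithmic trace along a differentiable curve. -/
theorem IsTracial.hasDerivAt_logTrace {τ : M →L[ℂ] ℂ} (hτ : IsTracial τ) {f : ℝ → M} {f' : M}
    {t : ℝ} (hf : HasDerivAt f f' t) (h1 : ‖f t - 1‖ < 1) (k : M) (hk : k * f t = 1) :
    HasDerivAt (fun s => logTrace τ (f s)) (τ (k * f')) t := by
  have h := ((hτ.hasFDerivAt_logTrace h1 k hk).restrictScalars ℝ).comp_hasDerivAt t hf
  simpa using! h

theorem eq_of_hasDerivAt_eq {F G : ℝ → ℂ} {c : ℝ → ℂ}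
    (hF : ∀ t ∈ Icc (0 : ℝ) 1, HasDerivAt F (c t) t)
    (hG : ∀ t ∈ Icc (0 : ℝ) 1, HasDerivAt G (c t) t) : F 1 - F 0 = G 1 - G 0 := by
  have h : ∀ t ∈ Icc (0 : ℝ) 1, HasDerivAt (fun s => F s - G s) 0 t := fun t ht => by
    simpa using (hF t ht).fun_sub (hG t ht)
  have h2 : F 1 - G 1 = F 0 - G 0 :=
    constant_of_derivWithin_zero (f := fun s => F s - G s) (a := 0) (b := 1)
    (fun t ht => (h t ht).differentiableAt.differentiableWithinAt)
    (fun t ht => ((h t (Ico_subset_Icc_self ht)).hasDerivWithinAt).derivWithin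
      (uniqueDiffOn_Icc zero_lt_one t (Ico_subset_Icc_self ht))) 1 (by simp)
  linear_combination h2

theorem exists_left_inv_of_norm_lt {g : M} (hg : ‖g - 1‖ < 1) : ∃ k, k * g = 1 ∧ g * k = 1 := by
  have h : ‖1 - g‖ < 1 := by rwa [← norm_neg, neg_sub]
  refine ⟨∑' n : ℕ, (1 - g) ^ n, ?_, ?_⟩
  · have := geom_series_mul_neg (1 - g) h
    rwa [sub_sub_cancel] at this
  · have := mul_neg_geom_series (1 - g) h
    rwa [sub_sub_cancel] at this

/-- Near `1`, the logarithmic trace is additive on products. -/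
theorem IsTracial.logTrace_mul {τ : M →L[ℂ] ℂ} (hτ : IsTracial τ) {g h : M}
    (hg : ‖g - 1‖ < 1 / 4) (hh : ‖h - 1‖ < 1 / 4) :
    logTrace τ (g * h) = logTrace τ g + logTrace τ h := by
  have hc : ∀ t : ℝ, HasDerivAt (fun s : ℝ => (1 : M) + s • (g - 1)) (g - 1) t := fun t => by
    simpa using ((hasDerivAt_id t).smul_const (g - 1)).const_add (1 : M)
  obtain ⟨h', hh1, hh2⟩ := exists_left_inv_of_norm_lt (hh.trans (by norm_num))
  have hsmall : ∀ t ∈ Icc (0 : ℝ) 1, ‖((1 : M) + t • (g - 1)) - 1‖ < 1 / 4 := by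
    intro t ht
    rw [add_sub_cancel_left, norm_smul, Real.norm_of_nonneg ht.1]
    exact (mul_le_of_le_one_left (norm_nonneg _) ht.2).trans_lt hg
  -- The radius 1/4 suffices because 1/16 + 1/4 + 1/4 < 1.
  have hprod : ∀ t ∈ Icc (0 : ℝ) 1, ‖((1 : M) + t • (g - 1)) * h - 1‖ < 1 := by
    intro t ht
    have e : ((1 : M) + t • (g - 1)) * h - 1
        = (((1 : M) + t • (g - 1)) - 1) * (h - 1) + (((1 : M) + t • (g - 1)) - 1) + (h - 1) := by
      noncomm_ring
    rw [e]
    have h1 := norm_mul_le (((1 : M) + t • (g - 1)) - 1) (h - 1)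
    have h2 := hsmall t ht
    have h3 := norm_add_le ((((1 : M) + t • (g - 1)) - 1) * (h - 1)
      + (((1 : M) + t • (g - 1)) - 1)) (h - 1)
    have h4 := norm_add_le ((((1 : M) + t • (g - 1)) - 1) * (h - 1))
      (((1 : M) + t • (g - 1)) - 1)
    nlinarith [norm_nonneg (((1 : M) + t • (g - 1)) - 1), norm_nonneg (h - 1)]
  choose! k hk1 hk2 using fun t (ht : t ∈ Icc (0 : ℝ) 1) =>
    exists_left_inv_of_norm_lt ((hsmall t ht).trans (by norm_num))
  -- Along the segment from 1 to g, right multiplication by h only conjugates the logarithmic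
  -- derivative k(g - 1) by h, which the trace does not see.
  have key := eq_of_hasDerivAt_eq (F := fun s : ℝ => logTrace τ (((1 : M) + s • (g - 1)) * h))
    (G := fun s : ℝ => logTrace τ ((1 : M) + s • (g - 1))) (c := fun t => τ (k t * (g - 1)))
    (fun t ht => by
      have := hτ.hasDerivAt_logTrace ((hc t).mul_const h) (hprod t ht) (h' * k t)
        (by rw [mul_assoc, ← mul_assoc (k t), hk1 t ht, one_mul, hh1])
      rw [show h' * k t * ((g - 1) * h) = h' * (k t * (g - 1)) * h by simp only [mul_assoc],
        hτ.apply_conj hh2] at this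
      exact this)
    (fun t ht => hτ.hasDerivAt_logTrace (hc t) ((hsmall t ht).trans (by norm_num)) _ (hk1 t ht))
  simp only [one_smul, add_sub_cancel, zero_smul, add_zero, one_mul, logTrace_one] at key
  linear_combination key

theorem exp_mul_exp_neg (x : M) : exp x * exp (-x) = 1 := by
  rw [← exp_add_of_commute (Commute.refl x).neg_right, add_neg_cancel, exp_zero]

theorem exp_neg_mul_exp (x : M) : exp (-x) * exp x = 1 := by
  simpa using exp_mul_exp_neg (-x)

/-- The logarithmic trace recovers the difference of the traces of nearby logarithms. -/
theorem IsTracial.logTrace_exp_mul_exp_neg {τ : M →L[ℂ] ℂ} (hτ : IsTracial τ) {l l' : M}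
    (h : ∀ t ∈ Icc (0 : ℝ) 1, ‖exp (t • l') * exp (-(t • l)) - 1‖ < 1) :
    logTrace τ (exp l' * exp (-l)) = τ l' - τ l := by
  have hd : ∀ t : ℝ, HasDerivAt (fun s : ℝ => exp (s • l') * exp (-(s • l)))
      (exp (t • l') * l' * exp (-(t • l)) + exp (t • l') * (exp (-(t • l)) * -l)) t := by
    intro t
    have h1 := hasDerivAt_exp_smul_const (𝕂 := ℝ) l' t
    have h2 := hasDerivAt_exp_smul_const (𝕂 := ℝ) (-l) t
    simp only [smul_neg] at h2
    exact h1.fun_mul h2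
  have key := eq_of_hasDerivAt_eq
    (F := fun s : ℝ => logTrace τ (exp (s • l') * exp (-(s • l))))
    (G := fun s : ℝ => (s : ℂ) * (τ l' - τ l)) (c := fun _ => τ l' - τ l)
    (fun t ht => by
      have h3 := hτ.hasDerivAt_logTrace (hd t) (h t ht) (exp (t • l) * exp (-(t • l')))
        (by
          rw [mul_assoc, ← mul_assoc (exp (-(t • l'))), exp_neg_mul_exp, one_mul,
            exp_mul_exp_neg])
      -- The logarithmic derivative is a conjugate of l' minus l, so its trace is the constant τ l'
      -- - τ l.
      have e : exp (t • l) * exp (-(t • l')) *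
          (exp (t • l') * l' * exp (-(t • l)) + exp (t • l') * (exp (-(t • l)) * -l))
          = exp (t • l) * l' * exp (-(t • l)) - l := by
        calc _ = exp (t • l) * (exp (-(t • l')) * exp (t • l')) * l' * exp (-(t • l))
              - exp (t • l) * (exp (-(t • l')) * exp (t • l')) * exp (-(t • l)) * l := by
              noncomm_ring
          _ = _ := by rw [exp_neg_mul_exp, mul_one, exp_mul_exp_neg, one_mul]
      rw [e, map_sub, hτ.apply_conj (exp_neg_mul_exp _)] at h3
      exact h3)
    (fun t _ => by
      simpa using (Complex.ofRealCLM.hasDerivAt (x := t)).mul_const (τ l' - τ l))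
  simpa [logTrace_one] using key

/-- The neighbourhood of l is the same for all τ, because only the norm bound along the compact
interval restricts l'. -/
theorem eventually_logTrace_exp_mul_exp_neg (l : M) :
    ∀ᶠ l' in 𝓝 l, ∀ τ : M →L[ℂ] ℂ, IsTracial τ →
      logTrace τ (exp l' * exp (-l)) = τ l' - τ l := by
  have h : ∀ᶠ l' in 𝓝 l, ∀ t ∈ Icc (0 : ℝ) 1, ‖exp (t • l') * exp (-(t • l)) - 1‖ < 1 := by
    refine isCompact_Icc.eventually_forall_of_forall_eventually fun t _ => ?_
    have hcont : Continuous fun z : M × ℝ => ‖exp (z.2 • z.1) * exp (-(z.2 • l)) - 1‖ := by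
      have := exp_continuous (𝔸 := M)
      fun_prop
    refine hcont.continuousAt.eventually_lt continuousAt_const ?_
    simp [exp_mul_exp_neg]
  filter_upwards [h] with l' hl' τ hτ
  exact hτ.logTrace_exp_mul_exp_neg hl'

theorem eventually_logTrace_exp :
    ∀ᶠ l : M in 𝓝 0, ∀ τ : M →L[ℂ] ℂ, IsTracial τ → logTrace τ (exp l) = τ l := by
  filter_upwards [eventually_logTrace_exp_mul_exp_neg (0 : M)] with l hl τ hτ
  simpa using hl τ hτ

end LogTrace

attribute [local instance] CStarAlgebra.spectralOrder CStarAlgebra.spectralOrderedRing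

/-! ### Invariant functionals, their Jordan decomposition, and the common kernel of the positive
traces. -/

section Jordan

variable {M : Type*} [CStarAlgebra M]

/-- Bounded positive tracial functionals, not necessarily normalized. -/
def IsPositiveTrace (τ : M →L[ℂ] ℂ) : Prop :=
  (∀ a : M, 0 ≤ τ (star a * a)) ∧ IsTracial τ

/-- Invariance gives τ(ub) = τ(bu) for unitary u, and the unitaries span M. -/
theorem isTracial_of_unitary {τ : M →L[ℂ] ℂ}
    (h : ∀ (u : unitary M) (a : M), τ (u * a * star (u : M)) = τ a) : IsTracial τ := by
  intro a b
  have ha : a ∈ Submodule.span ℂ (unitary M : Set M) := by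
    rw [CStarAlgebra.span_unitary]; trivial
  induction ha using Submodule.span_induction with
  | mem u hu =>
    have := h ⟨u, hu⟩ (b * u)
    simp only [mul_assoc, Unitary.mul_star_self_of_mem hu, mul_one] at this
    exact this
  | zero => simp
  | add x y _ _ hx hy => rw [add_mul, mul_add, map_add, map_add, hx, hy]
  | smul c x _ hx => rw [smul_mul_assoc, mul_smul_comm, map_smul, map_smul, hx]

theorem isSelfAdjoint_conj {h : M} (hh : IsSelfAdjoint h) (u : M) :
    IsSelfAdjoint (u * h * star u) := by
  have := hh.conjugate u
  simpa using this

/-- Bounded real functionals that are invariant under unitary conjugation. -/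
def IsUnitarilyInvariant (f : M →L[ℝ] ℝ) : Prop :=
  ∀ (u : unitary M) (a : M), f (u * a * star (u : M)) = f a

theorem IsUnitarilyInvariant.isTracial_extend {f : M →L[ℝ] ℝ} (hf : IsUnitarilyInvariant f) :
    IsTracial (StrongDual.extendRCLike (𝕜 := ℂ) f) := by
  refine isTracial_of_unitary fun u a => ?_
  rw [StrongDual.extendRCLike_apply, StrongDual.extendRCLike_apply, hf, ← smul_mul_assoc,
    ← mul_smul_comm, hf]

theorem IsUnitarilyInvariant.mul_comm {f : M →L[ℝ] ℝ} (hf : IsUnitarilyInvariant f) (a b : M) :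
    f (a * b) = f (b * a) := by
  have h := congrArg (RCLike.re : ℂ → ℝ) (hf.isTracial_extend a b)
  rwa [StrongDual.re_extendRCLike_apply, StrongDual.re_extendRCLike_apply] at h

theorem extend_apply_of_isSelfAdjoint {f : M →L[ℝ] ℝ} (hf : ∀ a, f (star a) = f a) {a : M}
    (ha : IsSelfAdjoint a) : StrongDual.extendRCLike (𝕜 := ℂ) f a = f a := by
  rw [StrongDual.extendRCLike_apply]
  have h : f (Complex.I • a) = 0 := by
    have h1 := hf (Complex.I • a)
    rw [star_smul, ha.star_eq] at h1
    simp only [Complex.star_def, Complex.conj_I, neg_smul, map_neg] at h1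
    linarith
  simp [h]

theorem IsUnitarilyInvariant.isPositiveTrace_extend {f : M →L[ℝ] ℝ} (hf : IsUnitarilyInvariant f)
    (hstar : ∀ a, f (star a) = f a) (hpos : ∀ a : M, 0 ≤ a → 0 ≤ f a) :
    IsPositiveTrace (StrongDual.extendRCLike (𝕜 := ℂ) f) := by
  refine ⟨fun a => ?_, hf.isTracial_extend⟩
  rw [extend_apply_of_isSelfAdjoint hstar (IsSelfAdjoint.star_mul_self a)]
  exact Complex.zero_le_real.2 (hpos _ (star_mul_self_nonneg a))

/-- The positive part of a real functional on the positive cone. -/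
noncomputable def supBelow (f : M →L[ℝ] ℝ) (a : M) : ℝ := sSup (f '' Icc 0 a)

theorem bddAbove_image_Icc (f : M →L[ℝ] ℝ) (a : M) : BddAbove (f '' Icc 0 a) := by
  refine ⟨‖f‖ * ‖a‖, ?_⟩
  rintro _ ⟨c, hc, rfl⟩
  refine (le_abs_self _).trans ((f.le_opNorm c).trans ?_)
  gcongr
  exact CStarAlgebra.norm_le_norm_of_nonneg_of_le hc.1 hc.2

theorem le_supBelow (f : M →L[ℝ] ℝ) {a c : M} (h0 : 0 ≤ c) (h : c ≤ a) : f c ≤ supBelow f a :=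
  le_csSup (bddAbove_image_Icc f a) ⟨c, ⟨h0, h⟩, rfl⟩

theorem supBelow_le (f : M →L[ℝ] ℝ) {a : M} (ha : 0 ≤ a) {r : ℝ}
    (h : ∀ c, 0 ≤ c → c ≤ a → f c ≤ r) : supBelow f a ≤ r := by
  refine csSup_le ⟨f 0, 0, ⟨le_rfl, ha⟩, rfl⟩ ?_
  rintro _ ⟨c, hc, rfl⟩
  exact h c hc.1 hc.2

theorem supBelow_nonneg (f : M →L[ℝ] ℝ) {a : M} (ha : 0 ≤ a) : 0 ≤ supBelow f a := by
  simpa using le_supBelow f le_rfl ha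

theorem supBelow_le_norm (f : M →L[ℝ] ℝ) {a : M} (ha : 0 ≤ a) : supBelow f a ≤ ‖f‖ * ‖a‖ := by
  refine supBelow_le f ha fun c h0 hc => ?_
  refine (le_abs_self _).trans ((f.le_opNorm c).trans ?_)
  gcongr
  exact CStarAlgebra.norm_le_norm_of_nonneg_of_le h0 hc

theorem exists_exp_eq {b : M} (hb : IsStrictlyPositive b) :
    ∃ l : M, IsSelfAdjoint l ∧ exp l = b :=
  ⟨CFC.log b, IsSelfAdjoint.log, CFC.exp_log b⟩

theorem exp_half_mul_exp_half (l : M) :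
    exp ((1 / 2 : ℝ) • l) * exp ((1 / 2 : ℝ) • l) = exp l := by
  rw [← exp_add_of_commute (Commute.refl _), ← add_smul]
  norm_num

/-- An element c ≤ a + b need not split as a sum of elements below a and b. Under an invariant f it
does: with s² = a + b + δ and c = sds, the trace property gives f(c) = f(da) + f(db) + δ f(d), where
0 ≤ d ≤ 1. -/
theorem IsUnitarilyInvariant.supBelow_add {f : M →L[ℝ] ℝ} (hf : IsUnitarilyInvariant f) {a b : M}
    (ha : 0 ≤ a) (hb : 0 ≤ b) : supBelow f (a + b) = supBelow f a + supBelow f b := by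
  refine le_antisymm (supBelow_le f (add_nonneg ha hb) fun c h0 hc => ?_) ?_
  · refine le_of_forall_pos_le_add fun ε hε => ?_
    -- The shift by δ makes a + b invertible, at the cost of an error of at most ε.
    obtain ⟨δ, hδ, hδ'⟩ : ∃ δ : ℝ, 0 < δ ∧ δ * ‖f‖ ≤ ε :=
      ⟨ε / (‖f‖ + 1), by positivity, by
        rw [div_mul_eq_mul_div, div_le_iff₀ (by positivity)]
        nlinarith [norm_nonneg f]⟩
    have hδp : IsStrictlyPositive (algebraMap ℝ M δ) :=
      ⟨algebraMap_nonneg M hδ.le, (hδ.ne'.isUnit).map (algebraMap ℝ M)⟩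
    obtain ⟨l, hl, hle⟩ := exists_exp_eq (hδp.nonneg_add (add_nonneg ha hb))
    set s := exp ((1 / 2 : ℝ) • l) with hs
    set k := exp (-((1 / 2 : ℝ) • l)) with hk
    have hks : k * s = 1 := exp_neg_mul_exp _
    have hsk : s * k = 1 := exp_mul_exp_neg _
    have hss : s * s = a + b + algebraMap ℝ M δ := by rw [hs, exp_half_mul_exp_half, hle]
    have hsa : IsSelfAdjoint ((1 / 2 : ℝ) • l) := (IsSelfAdjoint.all _).smul hl
    have hksa : IsSelfAdjoint k := hsa.neg.exp
    have hd0 : 0 ≤ k * c * k := hksa.conjugate_nonneg h0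
    have hd1 : k * c * k ≤ 1 := by
      have h1 : c ≤ s * s := by
        rw [hss]; exact hc.trans (le_add_of_nonneg_right (algebraMap_nonneg M hδ.le))
      have h2 := hksa.conjugate_le_conjugate h1
      rwa [← mul_assoc, hks, one_mul, hsk] at h2
    set d := k * c * k with hd
    have hcd : c = s * d * s := by
      rw [hd]
      calc c = (s * k) * c * (k * s) := by rw [hsk, hks, one_mul, mul_one]
        _ = _ := by simp only [mul_assoc]
    -- f(dx) equals f(√x d √x), and √x d √x lies between 0 and x.
    have hpart : ∀ x : M, 0 ≤ x → f (d * x) ≤ supBelow f x := by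
      intro x hx
      have e : f (d * x) = f (CFC.sqrt x * d * CFC.sqrt x) := by
        rw [hf.mul_comm _ (CFC.sqrt x), ← mul_assoc, CFC.sqrt_mul_sqrt_self x,
          hf.mul_comm]
      have hsx : IsSelfAdjoint (CFC.sqrt x) := (CFC.sqrt_nonneg x).isSelfAdjoint
      rw [e]
      refine le_supBelow f (hsx.conjugate_nonneg hd0) ?_
      have := hsx.conjugate_le_conjugate hd1
      rwa [mul_one, CFC.sqrt_mul_sqrt_self x] at this
    have hfd : f d ≤ ‖f‖ := by
      refine (le_abs_self _).trans ((f.le_opNorm d).trans ?_)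
      refine mul_le_of_le_one_right (norm_nonneg _) ?_
      exact (CStarAlgebra.norm_le_norm_of_nonneg_of_le hd0 hd1).trans norm_one_le
    have e : f c = f (d * a) + f (d * b) + δ * f d := by
      rw [hcd, hf.mul_comm (s * d), ← mul_assoc, hss, hf.mul_comm, mul_add, mul_add, map_add,
        map_add, ← Algebra.commutes, ← Algebra.smul_def, map_smul, smul_eq_mul]
    have h3 := hpart a ha
    have h4 := hpart b hb
    have h5 : δ * f d ≤ δ * ‖f‖ := by gcongr
    linarith
  · have h1 : supBelow f a ≤ supBelow f (a + b) - supBelow f b := by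
      refine supBelow_le f ha fun c h0 hc => ?_
      have h2 : supBelow f b ≤ supBelow f (a + b) - f c := by
        refine supBelow_le f hb fun c' h0' hc' => ?_
        have := le_supBelow f (add_nonneg h0 h0') (add_le_add hc hc')
        rw [map_add] at this
        linarith
      linarith
    linarith

theorem conj_le_conj_unitary (u : unitary M) {a b : M} (h : a ≤ b) :
    (u : M) * a * star (u : M) ≤ u * b * star (u : M) :=
  star_right_conjugate_le_conjugate h _

theorem IsUnitarilyInvariant.supBelow_conj {f : M →L[ℝ] ℝ} (hf : IsUnitarilyInvariant f)
    (u : unitary M) {a : M} (ha : 0 ≤ a) : supBelow f (u * a * star (u : M)) = supBelow f a := by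
  have key : ∀ (u : unitary M) {a : M}, 0 ≤ a →
      supBelow f a ≤ supBelow f (u * a * star (u : M)) := by
    intro u a ha
    refine supBelow_le f ha fun c h0 hc => ?_
    rw [← hf u c]
    exact le_supBelow f (star_right_conjugate_nonneg h0 _) (conj_le_conj_unitary u hc)
  refine le_antisymm ?_ (key u ha)
  have h := key (star u) (star_right_conjugate_nonneg ha (u : M))
  have e : ((star u : unitary M) : M) * (u * a * star (u : M)) * star ((star u : unitary M) : M)
      = a := by
    rw [Unitary.coe_star, star_star]
    calc _ = (star (u : M) * u) * a * (star (u : M) * u) := by simp only [mul_assoc]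
      _ = a := by rw [Unitary.coe_star_mul_self, one_mul, mul_one]
  rwa [e] at h

/-- A bounded unitarily invariant functional is dominated by a positive one. -/
theorem IsUnitarilyInvariant.exists_positive {f : M →L[ℝ] ℝ} (hf : IsUnitarilyInvariant f) :
    ∃ g : M →L[ℝ] ℝ, IsUnitarilyInvariant g ∧ (∀ a, g (star a) = g a) ∧
      (∀ a, 0 ≤ a → 0 ≤ g a) ∧ ∀ a, 0 ≤ a → f a ≤ g a := by
  let c : ℝ → M := fun r => algebraMap ℝ M r
  let s : M → M := fun a => (realPart a : M)
  have hs : ∀ a, IsSelfAdjoint (s a) := fun a => (realPart a).2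
  have hsn : ∀ a, ‖s a‖ ≤ ‖a‖ := fun a => realPart.norm_le a
  have hc0 : ∀ {r : ℝ}, 0 ≤ r → 0 ≤ c r := fun hr => algebraMap_nonneg M hr
  have hcn : ∀ {r : ℝ}, 0 ≤ r → ‖c r‖ ≤ r := fun {r} hr => by
    refine (norm_algebraMap M r).le.trans ?_
    rw [Real.norm_of_nonneg hr]
    exact mul_le_of_le_one_right hr norm_one_le
  have hcs : ∀ {a : M} {r : ℝ}, IsSelfAdjoint a → ‖a‖ ≤ r → 0 ≤ a + c r := by
    intro a r ha hr
    have h1 : -c ‖a‖ ≤ a := ha.neg_algebraMap_norm_le_self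
    have h2 : c ‖a‖ ≤ c r := algebraMap_mono M hr
    calc (0 : M) ≤ a + c ‖a‖ := by simpa using add_le_add_left h1 (c ‖a‖)
      _ ≤ a + c r := by gcongr
  let F : M → ℝ := supBelow f
  have hF : ∀ {a b : M}, 0 ≤ a → 0 ≤ b → F (a + b) = F a + F b := fun ha hb => hf.supBelow_add ha hb
  -- The additive function F on the positive cone is extended by G(a) = F(Re a + r) - F(r). By `hG`
  -- any r ≥ ‖Re a‖ gives the same value, so sums can be compared at a common r.
  let G : M → ℝ := fun a => F (s a + c ‖a‖) - F (c ‖a‖)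
  have hG : ∀ (a : M) (r : ℝ), ‖s a‖ ≤ r → G a = F (s a + c r) - F (c r) := by
    intro a r hr
    have hr0 : 0 ≤ r := (norm_nonneg _).trans hr
    have h1 := hF (hcs (hs a) hr) (hc0 (norm_nonneg a))
    have h2 := hF (hcs (hs a) (hsn a)) (hc0 hr0)
    rw [add_right_comm] at h2
    simp only [G]
    linarith
  have hadd : ∀ a b, G (a + b) = G a + G b := by
    intro a b
    have hsum : s (a + b) = s a + s b := by simp [s]
    have hr : ‖s (a + b)‖ ≤ ‖a‖ + ‖b‖ := (hsn _).trans (norm_add_le a b)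
    rw [hG (a + b) _ hr]
    have h1 := hF (hcs (hs a) (hsn a)) (hcs (hs b) (hsn b))
    have h2 := hF (hc0 (norm_nonneg a)) (hc0 (norm_nonneg b))
    have h3 : c (‖a‖ + ‖b‖) = c ‖a‖ + c ‖b‖ := map_add _ _ _
    rw [h3, hsum, add_add_add_comm, h1, h2]
    simp only [G]
    ring
  let G' : M →+ ℝ := AddMonoidHom.mk' G hadd
  have hbound : ∀ a, ‖G' a‖ ≤ (2 * ‖f‖) * ‖a‖ := by
    intro a
    have h1 : F (s a + c ‖a‖) ≤ ‖f‖ * (2 * ‖a‖) := by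
      refine (supBelow_le_norm f (hcs (hs a) (hsn a))).trans ?_
      gcongr
      have := norm_add_le (s a) (c ‖a‖)
      linarith [hsn a, hcn (norm_nonneg a)]
    have h2 : F (c ‖a‖) ≤ ‖f‖ * ‖a‖ := by
      refine (supBelow_le_norm f (hc0 (norm_nonneg a))).trans ?_
      gcongr
      exact hcn (norm_nonneg a)
    have h3 : 0 ≤ F (s a + c ‖a‖) := supBelow_nonneg f (hcs (hs a) (hsn a))
    have h4 : 0 ≤ F (c ‖a‖) := supBelow_nonneg f (hc0 (norm_nonneg a))
    have h5 : 0 ≤ ‖f‖ * ‖a‖ := by positivity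
    change |F (s a + c ‖a‖) - F (c ‖a‖)| ≤ _
    rw [abs_le]
    constructor <;> linarith
  have hcont : Continuous G' := AddMonoidHomClass.continuous_of_bound G' _ hbound
  have hGpos : ∀ a, 0 ≤ a → G a = F a := by
    intro a ha
    have h1 : s a = a := ha.isSelfAdjoint.coe_realPart
    simp only [G, h1]
    rw [hF ha (hc0 (norm_nonneg a))]
    ring
  refine ⟨G'.toRealLinearMap hcont, ?_, ?_, ?_, ?_⟩
  · intro u a
    change G _ = G a
    have h1 : s (u * a * star (u : M)) = u * s a * star (u : M) := by
      simp only [s, realPart_apply_coe, star_mul, star_star, mul_smul_comm, smul_mul_assoc,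
        mul_add, add_mul, mul_assoc]
    set r := max ‖s a‖ ‖s (u * a * star (u : M))‖
    have h2 : ∀ t : ℝ, (u : M) * c t * star (u : M) = c t := fun t => by
      change _ * algebraMap ℝ M t * _ = algebraMap ℝ M t
      rw [← Algebra.commutes, mul_assoc, Unitary.mul_star_self_of_mem u.2, mul_one]
    rw [hG _ r (le_max_right _ _), hG a r (le_max_left _ _), h1]
    nth_rewrite 1 [← h2 r]
    rw [← add_mul, ← mul_add]
    simp only [F]
    rw [hf.supBelow_conj u (hcs (hs a) (le_max_left _ _))]
  · intro a
    change G _ = G a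
    have h1 : s (star a) = s a := by
      simp only [s, realPart_apply_coe, star_star, add_comm]
    simp only [G, h1, norm_star]
  · intro a ha
    change 0 ≤ G a
    rw [hGpos a ha]
    exact supBelow_nonneg f ha
  · intro a ha
    change f a ≤ G a
    rw [hGpos a ha]
    exact le_supBelow f ha le_rfl

/-- A selfadjoint element killed by all positive traces is killed by all bounded unitarily
invariant functionals. -/
theorem IsUnitarilyInvariant.apply_eq_zero {f : M →L[ℝ] ℝ} (hf : IsUnitarilyInvariant f)
    (hstar : ∀ a, f (star a) = f a) {h : M} (hh : IsSelfAdjoint h)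
    (h0 : ∀ τ : M →L[ℂ] ℂ, IsPositiveTrace τ → τ h = 0) : f h = 0 := by
  obtain ⟨g, hg, hgs, hg0, hfg⟩ := hf.exists_positive
  have h1 := h0 _ (hg.isPositiveTrace_extend hgs hg0)
  -- f is the difference of the positive functionals g and g - f, both of which kill h.
  have hgf : IsUnitarilyInvariant (g - f) := fun u a => by
    simp only [_root_.sub_apply, hg u a, hf u a]
  have hgfs : ∀ a, (g - f) (star a) = (g - f) a := fun a => by
    simp only [_root_.sub_apply, hgs, hstar]
  have h2 := h0 _ (hgf.isPositiveTrace_extend hgfs fun a ha => by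
    simpa using hfg a ha)
  rw [extend_apply_of_isSelfAdjoint hgs hh] at h1
  rw [extend_apply_of_isSelfAdjoint hgfs hh] at h2
  simp only [_root_.sub_apply, Complex.ofReal_eq_zero] at h1 h2
  linarith

/-- Unitary conjugation on the selfadjoint part. -/
def conjSA (u : unitary M) (h : selfAdjoint M) : selfAdjoint M :=
  ⟨u * h * star (u : M), isSelfAdjoint_conj h.2 _⟩

/-- A closed subgroup of the selfadjoint part that contains all differences of unitarily conjugate
elements contains all elements that are killed by the positive traces. -/
theorem mem_of_forall_trace_eq_zero {K : AddSubgroup (selfAdjoint M)}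
    (hK : IsClosed (K : Set (selfAdjoint M)))
    (hconj : ∀ (u : unitary M) (h : selfAdjoint M), conjSA u h - h ∈ K) {h : selfAdjoint M}
    (h0 : ∀ τ : M →L[ℂ] ℂ, IsPositiveTrace τ → τ h = 0) : h ∈ K := by
  let V : Submodule ℝ (selfAdjoint M) :=
    Submodule.span ℝ {x | ∃ (u : unitary M) (k : selfAdjoint M), x = conjSA u k - k}
  have hVK : (V : Set (selfAdjoint M)) ⊆ K := by
    intro x hx
    -- K is only an additive subgroup, but its generators are stable under real scaling: r(uku⋆ - k)
    -- is the difference belonging to rk.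
    have key : ∀ r : ℝ, r • x ∈ K := by
      induction hx using Submodule.span_induction with
      | mem x hx =>
        obtain ⟨u, k, rfl⟩ := hx
        intro r
        have e : r • (conjSA u k - k) = conjSA u (r • k) - r • k := by
          apply Subtype.ext
          simp [conjSA, smul_sub]
        rw [e]
        exact hconj u _
      | zero => intro r; rw [smul_zero]; exact K.zero_mem
      | add x y _ _ hx hy => intro r; rw [smul_add]; exact K.add_mem (hx r) (hy r)
      | smul c x _ hx => intro r; rw [smul_smul]; exact hx _
    simpa using key 1
  by_contra hh
  have hnot : h ∉ closure (V : Set (selfAdjoint M)) := fun hc => hh (hK.closure_subset_iff.2 hVK hc)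
  obtain ⟨f, r, hf, hr⟩ := geometric_hahn_banach_closed_point (V.convex.closure) isClosed_closure
    hnot
  have hfV : ∀ x ∈ V, f x = 0 := by
    intro x hx
    by_contra hne
    -- This multiple of x has the value |r| + 1 > r under f, so f cannot be bounded by r on V unless
    -- it vanishes there.
    have := hf _ (subset_closure (V.smul_mem ((|r| + 1) / f x) hx))
    rw [map_smul, smul_eq_mul, div_mul_cancel₀ _ hne] at this
    linarith [le_abs_self r]
  have hr0 : 0 < r := by simpa using hf 0 (subset_closure V.zero_mem)
  -- The separating functional lives on the selfadjoint part; composing it with the real part makes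
  -- it an invariant functional on M.
  let R : M →L[ℝ] selfAdjoint M := (realPart : M →ₗ[ℝ] selfAdjoint M).mkContinuous 1 fun x => by
    simpa using realPart.norm_le x
  have hR : ∀ x, R x = realPart x := fun _ => rfl
  have hinv : IsUnitarilyInvariant (f.comp R) := by
    intro u a
    have e : R (u * a * star (u : M)) = conjSA u (R a) := by
      apply Subtype.ext
      simp only [hR, conjSA, realPart_apply_coe, star_mul, star_star, mul_smul_comm,
        smul_mul_assoc, mul_add, add_mul, mul_assoc]
    have := hfV _ (Submodule.subset_span ⟨u, R a, rfl⟩)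
    rw [map_sub] at this
    simp only [ContinuousLinearMap.comp_apply, e]
    linarith
  have hstar : ∀ a, (f.comp R) (star a) = (f.comp R) a := by
    intro a
    have e : R (star a) = R a := by
      apply Subtype.ext
      simp only [hR, realPart_apply_coe, star_star, add_comm]
    simp only [ContinuousLinearMap.comp_apply, e]
  have hz := hinv.apply_eq_zero hstar h.2 h0
  have e : R (h : M) = h := Subtype.ext h.2.coe_realPart
  simp only [ContinuousLinearMap.comp_apply, e] at hz
  linarith

end Jordan

/-! ### The Lie product formula. -/

section Trotter

variable {M : Type*} [CStarAlgebra M]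

theorem norm_exp_le_exp {x : M} {r : ℝ} (h : ‖x‖ ≤ r) : ‖exp x‖ ≤ Real.exp r := by
  refine le_trans ?_ (Real.exp_le_exp.2 h)
  rw [exp_eq_tsum_rat (𝔸 := M), Real.exp_eq_exp_ℝ, exp_eq_tsum_rat (𝔸 := ℝ)]
  have hs : Summable fun n : ℕ => (n.factorial : ℚ)⁻¹ • ‖x‖ ^ n :=
    (exp_series_hasSum_exp' (𝕂 := ℚ) ‖x‖).summable
  refine tsum_of_norm_bounded hs.hasSum fun n => ?_
  rw [norm_smul]
  have : ‖((n.factorial : ℚ)⁻¹)‖ = (n.factorial : ℝ)⁻¹ := by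
    rw [← Rat.norm_cast_real]; simp
  rw [this, Rat.smul_def]
  push_cast
  gcongr
  exact norm_pow_le_pow_norm x n

/-- Telescoping of aⁿ - bⁿ. -/
theorem norm_pow_sub_pow_le {a b : M} {C : ℝ} (hC : 1 ≤ C) (ha : ‖a‖ ≤ C) (hb : ‖b‖ ≤ C) (n : ℕ) :
    ‖a ^ n - b ^ n‖ ≤ n * C ^ n * ‖a - b‖ := by
  induction n with
  | zero => simp
  | succ n ih =>
    have e : a ^ (n + 1) - b ^ (n + 1) = a ^ n * (a - b) + (a ^ n - b ^ n) * b := by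
      rw [pow_succ, pow_succ]; noncomm_ring
    have h1 : ‖a ^ n * (a - b)‖ ≤ C ^ (n + 1) * ‖a - b‖ := by
      refine (norm_mul_le _ _).trans ?_
      gcongr
      refine (norm_pow_le_pow_norm a n).trans ?_
      calc ‖a‖ ^ n ≤ C ^ n := by gcongr
        _ ≤ C ^ (n + 1) := pow_le_pow_right₀ hC n.le_succ
    have h2 : ‖(a ^ n - b ^ n) * b‖ ≤ n * C ^ n * ‖a - b‖ * C := by
      refine (norm_mul_le _ _).trans ?_
      gcongr
    rw [e]
    refine (norm_add_le _ _).trans ((add_le_add h1 h2).trans (le_of_eq ?_))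
    push_cast
    ring

/-- The Lie product formula. -/
theorem tendsto_exp_mul_exp_pow (x y : M) :
    Tendsto (fun n : ℕ => (exp ((1 / ((n : ℝ) + 1)) • x) * exp ((1 / ((n : ℝ) + 1)) • y)) ^ (n + 1))
      atTop (𝓝 (exp (x + y))) := by
  -- The two sides agree to first order, so at t = 1/(n+1) they differ by o(t). Taking (n+1)-th
  -- powers multiplies this by at most (n+1) exp(‖x‖ + ‖y‖).
  have hd : HasDerivAt (fun t : ℝ => exp (t • x) * exp (t • y) - exp (t • (x + y))) 0 0 := by
    have h1 := hasDerivAt_exp_smul_const (𝕂 := ℝ) x 0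
    have h2 := hasDerivAt_exp_smul_const (𝕂 := ℝ) y 0
    have h3 := hasDerivAt_exp_smul_const (𝕂 := ℝ) (x + y) 0
    simpa using (h1.fun_mul h2).fun_sub h3
  have hslope := hd.tendsto_slope_zero
  have hu : Tendsto (fun n : ℕ => 1 / ((n : ℝ) + 1)) atTop (𝓝[≠] 0) :=
    tendsto_nhdsWithin_iff.2 ⟨tendsto_one_div_add_atTop_nhds_zero_nat,
      Eventually.of_forall fun n => by
        have : (n : ℝ) + 1 ≠ 0 := n.cast_add_one_ne_zero
        simpa using this⟩
  have h4 := (hslope.comp hu).norm.const_mul (Real.exp (‖x‖ + ‖y‖))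
  simp only [Function.comp_def, zero_add, zero_smul, exp_zero, mul_one, sub_self, sub_zero,
    norm_zero, mul_zero] at h4
  rw [tendsto_iff_norm_sub_tendsto_zero]
  refine squeeze_zero (fun _ => norm_nonneg _) (fun n => ?_) h4
  set t : ℝ := 1 / ((n : ℝ) + 1) with ht
  have ht0 : 0 < t := by positivity
  have htn : ((n : ℝ) + 1) * t = 1 := by rw [ht]; field_simp
  have hC : 1 ≤ Real.exp (t * (‖x‖ + ‖y‖)) := Real.one_le_exp (by positivity)
  have hnx : ∀ z : M, ‖t • z‖ ≤ t * ‖z‖ := fun z => by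
    rw [norm_smul, Real.norm_of_nonneg ht0.le]
  have ha : ‖exp (t • x) * exp (t • y)‖ ≤ Real.exp (t * (‖x‖ + ‖y‖)) := by
    rw [mul_add, Real.exp_add]
    exact (norm_mul_le _ _).trans (mul_le_mul (norm_exp_le_exp (hnx x)) (norm_exp_le_exp (hnx y))
      (norm_nonneg _) (Real.exp_pos _).le)
  have hb : ‖exp (t • (x + y))‖ ≤ Real.exp (t * (‖x‖ + ‖y‖)) := by
    refine norm_exp_le_exp ((hnx _).trans ?_)
    gcongr
    exact norm_add_le x y
  have hpow : exp (t • (x + y)) ^ (n + 1) = exp (x + y) := by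
    rw [← exp_nsmul, ← Nat.cast_smul_eq_nsmul ℝ, smul_smul]
    push_cast
    rw [htn, one_smul]
  have hCn : Real.exp (t * (‖x‖ + ‖y‖)) ^ (n + 1) = Real.exp (‖x‖ + ‖y‖) := by
    rw [← Real.exp_nat_mul, ← mul_assoc]
    push_cast
    rw [htn, one_mul]
  have h5 := norm_pow_sub_pow_le hC ha hb (n + 1)
  rw [hpow, hCn] at h5
  refine h5.trans (le_of_eq ?_)
  have : t⁻¹ = (n : ℝ) + 1 := by rw [ht]; simp
  rw [norm_smul, norm_inv, Real.norm_of_nonneg ht0.le, this]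
  push_cast
  ring

end Trotter

/-! ### Homomorphisms with closed kernel on exponentials. -/

section ExponentialHom

variable {G Q X : Type*} [Group G] [TopologicalSpace G] [IsTopologicalGroup G] [CommGroup Q]
  [AddCommGroup X] [Module ℝ X]

/-- In a commutative target every term of the product formula has the image q(e x) q(e y).
Closedness of the kernel carries this to the limit, so Q needs no topology. The abstract e covers
both exp(h) in the invertibles and exp(ih) in the unitaries. -/
theorem map_exp_add_of_product_formula {q : G →* Q} (hq : IsClosed (q.ker : Set G)) {e : X → G}
    (hpow : ∀ (x : X) (n : ℕ), e ((1 / ((n : ℝ) + 1)) • x) ^ (n + 1) = e x)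
    {x y : X} (hlim : Tendsto (fun n : ℕ => (e ((1 / ((n : ℝ) + 1)) • x) *
      e ((1 / ((n : ℝ) + 1)) • y)) ^ (n + 1)) atTop (𝓝 (e (x + y)))) :
    q (e (x + y)) = q (e x) * q (e y) := by
  have h1 := hlim.mul_const (e x * e y)⁻¹
  have h2 := hq.mem_of_tendsto h1 (Eventually.of_forall fun n => by
    rw [SetLike.mem_coe, MonoidHom.mem_ker, map_mul, map_pow, map_mul, mul_pow, ← map_pow,
      ← map_pow, hpow, hpow, map_inv, map_mul, mul_inv_cancel])
  rwa [SetLike.mem_coe, MonoidHom.mem_ker, map_mul, map_inv, map_mul, mul_inv_eq_one] at h2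

variable {M : Type*} [CStarAlgebra M]

/-- If a family of exponentials satisfies the product formula, its composite with a homomorphism to
a commutative group with closed kernel is determined by the positive traces. -/
theorem map_exp_eq_of_forall_trace {q : G →* Q} (hq : IsClosed (q.ker : Set G))
    {e : selfAdjoint M → G} (hcont : Continuous e) (hzero : e 0 = 1)
    (hpow : ∀ (x : selfAdjoint M) (n : ℕ), e ((1 / ((n : ℝ) + 1)) • x) ^ (n + 1) = e x)
    (hlim : ∀ x y : selfAdjoint M, Tendsto (fun n : ℕ => (e ((1 / ((n : ℝ) + 1)) • x) *
      e ((1 / ((n : ℝ) + 1)) • y)) ^ (n + 1)) atTop (𝓝 (e (x + y))))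
    (hconj : ∀ u : unitary M, ∃ g : G, ∀ h, e (conjSA u h) = g * e h * g⁻¹)
    {h k : selfAdjoint M}
    (htr : ∀ τ : M →L[ℂ] ℂ, IsPositiveTrace τ → τ h = τ k) : q (e h) = q (e k) := by
  have hadd : ∀ x y, q (e (x + y)) = q (e x) * q (e y) := fun x y =>
    map_exp_add_of_product_formula hq hpow (hlim x y)
  have hneg : ∀ x, q (e (-x)) = (q (e x))⁻¹ := fun x => by
    rw [eq_inv_iff_mul_eq_one, ← hadd, neg_add_cancel, hzero, map_one]
  let K : AddSubgroup (selfAdjoint M) :=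
    { carrier := {x | q (e x) = 1}
      zero_mem' := by simp [hzero]
      add_mem' := fun {x y} hx hy => by
        simp only [mem_ofPred_eq] at hx hy ⊢
        rw [hadd, hx, hy, one_mul]
      neg_mem' := fun {x} hx => by
        simp only [mem_ofPred_eq] at hx ⊢
        rw [hneg, hx, inv_one] }
  have hK : IsClosed (K : Set (selfAdjoint M)) := hq.preimage hcont
  have hmem : h - k ∈ K := by
    refine mem_of_forall_trace_eq_zero hK (fun u x => ?_) fun τ hτ => ?_
    · change q (e (conjSA u x - x)) = 1
      obtain ⟨g, hg⟩ := hconj u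
      rw [sub_eq_add_neg, hadd, hneg, hg, map_mul, map_mul, map_inv, mul_inv_cancel_comm,
        mul_inv_cancel]
    · rw [AddSubgroup.coe_sub, map_sub, htr τ hτ, sub_self]
  have h1 : q (e (h - k)) = 1 := hmem
  rw [← sub_add_cancel h k, hadd, h1, one_mul]

end ExponentialHom

/-! ### The invertible and the unitary group of a C⋆-algebra. -/

section Applications

variable {M : Type*} [CStarAlgebra M] {Q : Type*} [CommGroup Q]

/-- The exponential as an invertible element. -/
noncomputable def expUnit (x : M) : Mˣ := ⟨exp x, exp (-x), exp_mul_exp_neg x, exp_neg_mul_exp x⟩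

theorem coe_expUnit (x : M) : (expUnit x : M) = exp x := rfl

theorem continuous_expUnit : Continuous (expUnit : M → Mˣ) := by
  rw [Units.continuous_iff]
  have h := exp_continuous (𝔸 := M)
  exact ⟨h, h.comp continuous_neg⟩

theorem exp_one_div_smul_pow (x : M) (n : ℕ) : exp ((1 / ((n : ℝ) + 1)) • x) ^ (n + 1) = exp x := by
  rw [← exp_nsmul, ← Nat.cast_smul_eq_nsmul ℝ, smul_smul]
  have : ((n + 1 : ℕ) : ℝ) * (1 / ((n : ℝ) + 1)) = 1 := by push_cast; field_simp
  rw [this, one_smul]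

theorem exp_unitary_conj (u : unitary M) (x : M) :
    exp ((u : M) * x * star (u : M)) = u * exp x * star (u : M) :=
  exp_units_conj (Unitary.toUnits u) x

/-- A homomorphism with closed kernel on the invertible elements: its values on exponentials of
selfadjoint elements are determined by the positive traces. -/
theorem map_expUnit_eq_of_forall_trace {q : Mˣ →* Q} (hq : IsClosed (q.ker : Set Mˣ))
    {h k : M} (hh : IsSelfAdjoint h) (hk : IsSelfAdjoint k)
    (htr : ∀ τ : M →L[ℂ] ℂ, IsPositiveTrace τ → τ h = τ k) :
    q (expUnit h) = q (expUnit k) := by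
  refine map_exp_eq_of_forall_trace (M := M) (h := ⟨h, hh⟩) (k := ⟨k, hk⟩) hq
    (e := fun x : selfAdjoint M => expUnit (x : M))
    (continuous_expUnit.comp continuous_subtype_val) ?_ (fun x n => ?_) (fun x y => ?_)
    (fun u => ⟨Unitary.toUnits u, fun h => ?_⟩) htr
  · ext; simp [coe_expUnit]
  · ext; simpa [coe_expUnit] using exp_one_div_smul_pow (x : M) n
  · rw [Units.isOpenEmbedding_val.isEmbedding.tendsto_nhds_iff]
    exact tendsto_exp_mul_exp_pow (x : M) y
  · ext
    exact exp_unitary_conj u h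

/-- The same for the unitary group and exponentials of skewadjoint elements. -/
theorem map_expUnitary_eq_of_forall_trace {q : unitary M →* Q}
    (hq : IsClosed (q.ker : Set (unitary M))) {h k : selfAdjoint M}
    (htr : ∀ τ : M →L[ℂ] ℂ, IsPositiveTrace τ → τ h = τ k) :
    q (selfAdjoint.expUnitary h) = q (selfAdjoint.expUnitary k) := by
  refine map_exp_eq_of_forall_trace (M := M) hq (e := selfAdjoint.expUnitary)
    selfAdjoint.continuous_expUnitary selfAdjoint.expUnitary_zero (fun x n => ?_) (fun x y => ?_)
    (fun u => ⟨u, fun h => ?_⟩) htr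
  · ext
    have := exp_one_div_smul_pow (Complex.I • (x : M)) n
    rw [smul_comm] at this
    simpa using this
  · rw [tendsto_subtype_rng]
    have := tendsto_exp_mul_exp_pow (Complex.I • (x : M)) (Complex.I • (y : M))
    simp only [smul_comm _ Complex.I, ← smul_add] at this
    simpa using this
  · ext
    have := exp_unitary_conj u (Complex.I • (h : M))
    rw [mul_smul_comm, smul_mul_assoc] at this
    simpa [conjSA] using! this

/-- Near `1`, a unitary on which all logarithmic traces vanish is killed by every homomorphism to a
commutative group with closed kernel. -/
theorem eventually_map_eq_one_of_logTrace {q : unitary M →* Q}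
    (hq : IsClosed (q.ker : Set (unitary M))) :
    ∀ᶠ w : unitary M in 𝓝 1,
      (∀ τ : M →L[ℂ] ℂ, IsPositiveTrace τ → logTrace τ (w : M) = 0) → q w = 1 := by
  have harg : Tendsto (fun w : unitary M => Complex.I • (Unitary.argSelfAdjoint w : M)) (𝓝 1)
      (𝓝 0) := by
    have h1 : ContinuousAt (Unitary.argSelfAdjoint : unitary M → selfAdjoint M) 1 :=
      Unitary.continuousOn_argSelfAdjoint.continuousAt (Metric.ball_mem_nhds 1 (by norm_num))
    have h0 : Unitary.argSelfAdjoint (1 : unitary M) = 0 := by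
      rw [← selfAdjoint.expUnitary_zero]
      exact argSelfAdjoint_expUnitary (by simpa using Real.pi_pos)
    have h2 : Tendsto (fun w : unitary M => (Unitary.argSelfAdjoint w : M)) (𝓝 1) (𝓝 0) := by
      have := (continuous_subtype_val.tendsto _).comp h1.tendsto
      rw [h0] at this
      exact this
    simpa using h2.const_smul Complex.I
  filter_upwards [harg.eventually eventually_logTrace_exp,
    Metric.ball_mem_nhds (1 : unitary M) (ε := 2) (by norm_num)] with w hw hball h0
  have hw2 : selfAdjoint.expUnitary (Unitary.argSelfAdjoint w) = w := by
    refine expUnitary_argSelfAdjoint ?_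
    rwa [Metric.mem_ball, Subtype.dist_eq, dist_eq_norm] at hball
  -- Here w = exp(ih) with ih small, so `logTrace τ w` is iτ(h). Its vanishing for all τ makes h
  -- indistinguishable from 0 by traces.
  have h3 : q (selfAdjoint.expUnitary (Unitary.argSelfAdjoint w))
      = q (selfAdjoint.expUnitary 0) := by
    refine map_expUnitary_eq_of_forall_trace hq fun τ hτ => ?_
    have h4 := hw τ hτ.2
    rw [← selfAdjoint.expUnitary_coe, hw2, h0 τ hτ, map_smul, smul_eq_mul] at h4
    simpa using h4.symm
  rwa [hw2, selfAdjoint.expUnitary_zero, map_one] at h3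

end Applications

/-! ### Polar decomposition of invertible elements. -/

section Polar

variable {M : Type*} [CStarAlgebra M]

/-- The logarithm of `x⋆ x`. -/
noncomputable def logAbsSq (x : M) : M := CFC.log (star x * x)

theorem isSelfAdjoint_logAbsSq (x : M) : IsSelfAdjoint (logAbsSq x) := IsSelfAdjoint.log

theorem exp_logAbsSq (x : Mˣ) : exp (logAbsSq (x : M)) = star (x : M) * x := by
  have h : IsStrictlyPositive (star (x : M) * x) :=
    ⟨star_mul_self_nonneg _, (x.isUnit.star).mul x.isUnit⟩
  exact CFC.exp_log _ h

theorem continuous_logAbsSq : Continuous fun x : Mˣ => logAbsSq (x : M) :=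
  CFC.continuousOn_log.comp_continuous (Units.continuous_val.star.mul Units.continuous_val)
    fun x => ⟨IsSelfAdjoint.star_mul_self _, (x.isUnit.star).mul x.isUnit⟩

theorem logAbsSq_unitary_mul (u : unitary M) (x : M) : logAbsSq ((u : M) * x) = logAbsSq x := by
  rw [logAbsSq, star_mul, mul_assoc, ← mul_assoc (star (u : M)), Unitary.star_mul_self_of_mem u.2,
    one_mul, logAbsSq]

theorem logAbsSq_exp {h : M} (hh : IsSelfAdjoint h) : logAbsSq (exp h) = (2 : ℝ) • h := by
  rw [logAbsSq, hh.exp.star_eq, ← exp_add_of_commute (Commute.refl h), ← two_smul ℝ h]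
  exact CFC.log_exp _ ((IsSelfAdjoint.all _).smul hh)

/-- The logarithm of the absolute value. -/
noncomputable def logAbs (x : M) : M := (1 / 2 : ℝ) • logAbsSq x

theorem isSelfAdjoint_logAbs (x : M) : IsSelfAdjoint (logAbs x) :=
  (IsSelfAdjoint.all _).smul (isSelfAdjoint_logAbsSq x)

theorem exp_logAbs_mul_self (x : Mˣ) :
    exp (logAbs (x : M)) * exp (logAbs (x : M)) = star (x : M) * x := by
  rw [logAbs, exp_half_mul_exp_half, exp_logAbsSq]

theorem continuous_logAbs : Continuous fun x : Mˣ => logAbs (x : M) :=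
  continuous_logAbsSq.const_smul _

theorem expUnit_neg (x : M) : expUnit (-x) = (expUnit x)⁻¹ :=
  Units.ext (by simp [expUnit])

theorem expUnit_add_smul (s t : ℝ) (x : M) :
    expUnit ((s + t) • x) = expUnit (s • x) * expUnit (t • x) := by
  ext
  rw [Units.val_mul, coe_expUnit, coe_expUnit, coe_expUnit, add_smul,
    exp_add_of_commute (((Commute.refl x).smul_left s).smul_right t)]

/-- The unitary part in the polar decomposition of an invertible element. -/
noncomputable def polar (x : Mˣ) : unitary M :=
  ⟨(x : M) * exp (-logAbs (x : M)), by
    have hsa : star (exp (-logAbs (x : M))) = exp (-logAbs (x : M)) :=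
      (isSelfAdjoint_logAbs (x : M)).neg.exp.star_eq
    have h1 : star ((x : M) * exp (-logAbs (x : M))) * ((x : M) * exp (-logAbs (x : M))) = 1 := by
      rw [star_mul, hsa]
      calc _ = exp (-logAbs (x : M)) * (star (x : M) * x) * exp (-logAbs (x : M)) := by
            simp only [mul_assoc]
        _ = (exp (-logAbs (x : M)) * exp (logAbs (x : M))) *
            (exp (logAbs (x : M)) * exp (-logAbs (x : M))) := by
            rw [← exp_logAbs_mul_self]; simp only [mul_assoc]
        _ = 1 := by rw [exp_neg_mul_exp, exp_mul_exp_neg, one_mul]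
    have hu : IsUnit ((x : M) * exp (-logAbs (x : M))) :=
      x.isUnit.mul (expUnit (-logAbs (x : M))).isUnit
    exact ⟨h1, by
      obtain ⟨v, hv⟩ := hu
      rw [← hv] at h1 ⊢
      exact (Units.eq_inv_of_mul_eq_one_right h1) ▸ v.mul_inv⟩⟩

theorem polar_mul_expUnit (x : Mˣ) : Unitary.toUnits (polar x) * expUnit (logAbs (x : M)) = x := by
  ext
  change (x : M) * exp (-logAbs (x : M)) * exp (logAbs (x : M)) = x
  rw [mul_assoc, exp_neg_mul_exp, mul_one]

theorem continuous_polar : Continuous (polar : Mˣ → unitary M) := by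
  refine Continuous.subtype_mk ?_ _
  exact Units.continuous_val.mul ((exp_continuous (𝔸 := M)).comp continuous_logAbs.neg)

theorem polar_unitary_mul (u : unitary M) (x : Mˣ) :
    polar (Unitary.toUnits u * x) = u * polar x := by
  ext
  change (u : M) * x * exp (-logAbs ((u : M) * x)) = u * (x * exp (-logAbs (x : M)))
  rw [logAbs, logAbsSq_unitary_mul, mul_assoc, ← logAbs]

theorem polar_toUnits (u : unitary M) : polar (Unitary.toUnits u) = u := by
  have h : polar (1 : Mˣ) = 1 := by
    ext
    simp [polar, logAbs, logAbsSq]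
  have := polar_unitary_mul u 1
  rwa [mul_one, h, mul_one] at this

theorem continuous_toUnits : Continuous (Unitary.toUnits : unitary M → Mˣ) := by
  rw [Units.continuous_iff]
  exact ⟨continuous_subtype_val, continuous_subtype_val.star⟩

theorem continuous_expUnit_smul (s : M) (t₀ : ℝ) :
    Continuous fun t : ℝ => expUnit ((t - t₀) • s) :=
  continuous_expUnit.comp ((continuous_id.sub continuous_const).smul continuous_const)

theorem eventually_norm_sub_one_lt : ∀ᶠ g : Mˣ in 𝓝 1, ‖(g : M) - 1‖ < 1 / 4 := by
  have : Continuous fun g : Mˣ => ‖(g : M) - 1‖ := (Units.continuous_val.sub continuous_const).norm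
  exact this.continuousAt.eventually_lt continuousAt_const (by simp)

theorem eventually_expUnit_smul_mul (s : M) (t₀ : ℝ) :
    ∀ᶠ t : ℝ in 𝓝 t₀, ∀ τ : M →L[ℂ] ℂ, IsTracial τ →
      logTrace τ (exp ((t - t₀) • s)) = (t - t₀) • τ s := by
  have h : Tendsto (fun t : ℝ => (t - t₀) • s) (𝓝 t₀) (𝓝 0) := by
    have : Continuous fun t : ℝ => (t - t₀) • s := by fun_prop
    simpa using this.tendsto t₀
  filter_upwards [h.eventually eventually_logTrace_exp] with t ht τ hτ
  rw [ht τ hτ]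
  exact (τ.restrictScalars ℝ).map_smul _ _

/-! ### Multiplicativity of the unitary part. -/

section PolarHom

variable {Q : Type*} [CommGroup Q]

/-- Let E_t = exp((t - t₀)s), and let z_t be the change of the unitary part of E_t y since t₀. A
commutator identity shows that all logarithmic traces of z_t vanish for t near t₀, whence q(z_t) =
1. -/
theorem eventually_map_polar_eq {q : unitary M →* Q} (hq : IsClosed (q.ker : Set (unitary M)))
    {s : M} (hs : IsSelfAdjoint s) (y : Mˣ) (t₀ : ℝ) :
    ∀ᶠ t : ℝ in 𝓝 t₀, q (polar (expUnit ((t - t₀) • s) * y)) = q (polar y) := by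
  set E : ℝ → Mˣ := fun t => expUnit ((t - t₀) • s) with hE
  have hEc : Continuous E := continuous_expUnit_smul s t₀
  have hE0 : E t₀ = 1 := by ext; simp [hE, coe_expUnit]
  set w : ℝ → unitary M := fun t => polar (E t * y) with hw
  have hwc : Continuous w := continuous_polar.comp (hEc.mul continuous_const)
  have hw0 : w t₀ = polar y := by simp [hw, hE0]
  set H : ℝ → Mˣ := fun t => expUnit (logAbs ((E t * y : Mˣ) : M)) with hH
  have hHc : Continuous H :=
    continuous_expUnit.comp (continuous_logAbs.comp (hEc.mul continuous_const))
  have hHsa : ∀ t, IsSelfAdjoint (H t : M) := fun t => (isSelfAdjoint_logAbs _).exp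
  have hwH : ∀ t, Unitary.toUnits (w t) * H t = E t * y := fun t => polar_mul_expUnit _
  set W : Mˣ := Unitary.toUnits (w t₀) with hW
  have hWsa : ∀ g : Mˣ, IsSelfAdjoint (g : M) → IsSelfAdjoint ((W * g * W⁻¹ : Mˣ) : M) :=
    fun g hg => isSelfAdjoint_conj hg (w t₀ : M)
  set k : Mˣ := W * H t₀ * W⁻¹ with hk
  set h : ℝ → Mˣ := fun t => W * H t * W⁻¹ with hh
  set z : ℝ → unitary M := fun t => w t * (w t₀)⁻¹ with hz
  have hzc : Continuous z := hwc.mul continuous_const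
  have hz0 : z t₀ = 1 := by simp [hz]
  have h1 : ∀ t, E t * k = Unitary.toUnits (z t) * h t := by
    intro t
    have e1 := hwH t
    have e2 := hwH t₀
    rw [hE0, one_mul] at e2
    have e3 : Unitary.toUnits (z t) * W = Unitary.toUnits (w t) := by
      rw [hW, ← map_mul, hz]; simp
    calc E t * k = E t * (W * H t₀) * W⁻¹ := by rw [hk]; group
      _ = Unitary.toUnits (w t) * H t * W⁻¹ := by rw [hW, e2, ← e1]
      _ = Unitary.toUnits (z t) * W * H t * W⁻¹ := by rw [e3]
      _ = _ := by rw [hh]; group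
  -- This is the adjoint of `h1`: E, k and h are selfadjoint and z is unitary.
  have h2 : ∀ t, k * E t = h t * (Unitary.toUnits (z t))⁻¹ := by
    intro t
    ext
    have e := congrArg (fun g : Mˣ => star (g : M)) (h1 t)
    simp only [Units.val_mul, star_mul] at e
    have hEsa : IsSelfAdjoint (E t : M) := ((IsSelfAdjoint.all _).smul hs).exp
    rw [hEsa.star_eq, (hWsa _ (hHsa t₀)).star_eq, (hWsa _ (hHsa t)).star_eq] at e
    exact e
  -- On the left is E times a conjugate of E⁻¹, of total logarithmic trace 0. On the right is z
  -- times a conjugate of z, of total logarithmic trace twice that of z.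
  have h3 : ∀ t, E t * (k * (E t)⁻¹ * k⁻¹)
      = Unitary.toUnits (z t) * (h t * Unitary.toUnits (z t) * (h t)⁻¹) := by
    intro t
    have e : (E t)⁻¹ * k⁻¹ = Unitary.toUnits (z t) * (h t)⁻¹ := by
      rw [← mul_inv_rev, h2 t, mul_inv_rev, inv_inv]
    calc _ = (E t * k) * ((E t)⁻¹ * k⁻¹) := by group
      _ = _ := by rw [h1 t, e]; group
  have hlim : ∀ f : ℝ → Mˣ, Continuous f → f t₀ = 1 → ∀ᶠ t in 𝓝 t₀, ‖(f t : M) - 1‖ < 1 / 4 := by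
    intro f hf hf0
    have := hf.tendsto t₀
    rw [hf0] at this
    exact this.eventually eventually_norm_sub_one_lt
  have hhc : Continuous h := (continuous_const.mul hHc).mul continuous_const
  have hzuc : Continuous fun t => Unitary.toUnits (z t) := continuous_toUnits.comp hzc
  have hzlim : Tendsto z (𝓝 t₀) (𝓝 1) := by simpa [hz0] using hzc.tendsto t₀
  filter_upwards [hlim E hEc hE0,
    hlim (fun t => k * (E t)⁻¹ * k⁻¹) ((continuous_const.mul hEc.inv).mul continuous_const)
      (by simp [hE0]),
    hlim (fun t => Unitary.toUnits (z t)) hzuc (by simp [hz0]),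
    hlim (fun t => h t * Unitary.toUnits (z t) * (h t)⁻¹) ((hhc.mul hzuc).mul hhc.inv)
      (by simp [hz0]),
    eventually_expUnit_smul_mul s t₀, eventually_expUnit_smul_mul (-s) t₀,
    hzlim.eventually (eventually_map_eq_one_of_logTrace hq)] with t n1 n2 n3 n4 l1 l2 hqz
  have hz1 : q (z t) = 1 := by
    refine hqz fun τ hτ => ?_
    have e := congrArg (fun g : Mˣ => logTrace τ (g : M)) (h3 t)
    simp only [Units.val_mul] at e n2 n4
    rw [hτ.2.logTrace_mul n1 n2, hτ.2.logTrace_mul n3 n4,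
      hτ.2.logTrace_conj (Units.inv_mul k) (Units.mul_inv k),
      hτ.2.logTrace_conj (Units.inv_mul (h t)) (Units.mul_inv (h t))] at e
    have e1 : ((E t)⁻¹ : Mˣ) = expUnit ((t - t₀) • -s) := by
      rw [smul_neg, expUnit_neg]
    rw [e1, hE, coe_expUnit, coe_expUnit, l1 τ hτ.2, l2 τ hτ.2, map_neg, smul_neg,
      add_neg_cancel] at e
    have e2 : (2 : ℂ) * logTrace τ (z t : M) = 0 := by
      rw [two_mul]; exact e.symm
    simpa using e2
  rwa [hz, map_mul, map_inv, mul_inv_eq_one, hw0] at hz1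

/-- The class of the unitary part is locally constant along t ↦ exp(ts)y, hence constant because ℝ
is connected. With x = u exp(s), this reduces multiplicativity to `polar_unitary_mul`. -/
theorem map_polar_expUnit_mul {q : unitary M →* Q} (hq : IsClosed (q.ker : Set (unitary M)))
    {s : M} (hs : IsSelfAdjoint s) (y : Mˣ) : q (polar (expUnit s * y)) = q (polar y) := by
  have hloc : IsLocallyConstant fun t : ℝ => q (polar (expUnit (t • s) * y)) := by
    rw [IsLocallyConstant.iff_eventually_eq]
    intro t₀
    filter_upwards [eventually_map_polar_eq hq hs (expUnit (t₀ • s) * y) t₀] with t ht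
    rwa [← mul_assoc, ← expUnit_add_smul, sub_add_cancel] at ht
  have h := hloc.apply_eq_of_preconnectedSpace 1 0
  have h0 : expUnit (0 : M) = 1 := by ext; simp [coe_expUnit]
  simpa [h0] using h

/-- The unitary part is multiplicative modulo the kernel of every homomorphism to a commutative
group with closed kernel. -/
theorem map_polar_mul {q : unitary M →* Q} (hq : IsClosed (q.ker : Set (unitary M))) (x y : Mˣ) :
    q (polar (x * y)) = q (polar x) * q (polar y) := by
  conv_lhs => rw [← polar_mul_expUnit x, mul_assoc, polar_unitary_mul, map_mul,
    map_polar_expUnit_mul hq (isSelfAdjoint_logAbs (x : M))]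

end PolarHom

/-! ### The Fuglede–Kadison determinant. -/

section Determinant

/-- With E = exp((t - t₀)s), the product of (Ey)⋆(Ey) and (y⋆y)⁻¹ is y⋆E²(y⋆)⁻¹, a conjugate of E².
The logarithmic trace turns this into the difference of the traces of the two logarithms. -/
theorem eventually_trace_logAbsSq (s : M) (hs : IsSelfAdjoint s) (y : Mˣ) (t₀ : ℝ)
    {τ : M →L[ℂ] ℂ} (hτ : IsTracial τ) :
    ∀ᶠ t : ℝ in 𝓝 t₀, τ (logAbsSq (exp ((t - t₀) • s) * (y : M)))
      = τ (logAbsSq (y : M)) + (2 * (t - t₀)) • τ s := by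
  have hc : Tendsto (fun t : ℝ => logAbsSq ((expUnit ((t - t₀) • s) * y : Mˣ) : M)) (𝓝 t₀)
      (𝓝 (logAbsSq (y : M))) := by
    have hcont : Continuous fun t : ℝ => logAbsSq ((expUnit ((t - t₀) • s) * y : Mˣ) : M) :=
      continuous_logAbsSq.comp ((continuous_expUnit_smul s t₀).mul continuous_const)
    have := hcont.tendsto t₀
    simpa only [sub_self, zero_smul, Units.val_mul, coe_expUnit, exp_zero, one_mul] using this
  filter_upwards [hc.eventually (eventually_logTrace_exp_mul_exp_neg (logAbsSq (y : M))),
    eventually_expUnit_smul_mul ((2 : ℝ) • s) t₀] with t h1 h2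
  have e1 := h1 τ hτ
  have e2 := h2 τ hτ
  have hE : star (exp ((t - t₀) • s)) = exp ((t - t₀) • s) :=
    ((IsSelfAdjoint.all (t - t₀)).smul hs).exp.star_eq
  have hEE : exp ((t - t₀) • s) * exp ((t - t₀) • s) = exp ((t - t₀) • (2 : ℝ) • s) := by
    rw [← exp_add_of_commute (Commute.refl _), smul_comm, two_smul]
  have hinv : exp (-logAbsSq (y : M)) = (y⁻¹ : Mˣ) * star ((y⁻¹ : Mˣ) : M) := by
    refine left_inv_eq_right_inv (exp_neg_mul_exp _) ?_
    rw [exp_logAbsSq, mul_assoc, ← mul_assoc (y : M), Units.mul_inv, one_mul, ← star_mul,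
      Units.inv_mul, star_one]
  have hprod : exp (logAbsSq ((expUnit ((t - t₀) • s) * y : Mˣ) : M)) * exp (-logAbsSq (y : M))
      = star (y : M) * exp ((t - t₀) • (2 : ℝ) • s) * star ((y⁻¹ : Mˣ) : M) := by
    rw [exp_logAbsSq, hinv, ← hEE, Units.val_mul, coe_expUnit, star_mul, hE]
    calc _ = star (y : M) * (exp ((t - t₀) • s) * exp ((t - t₀) • s)) *
          (y * (y⁻¹ : Mˣ)) * star ((y⁻¹ : Mˣ) : M) := by simp only [mul_assoc]
      _ = _ := by rw [Units.mul_inv, mul_one]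
  rw [hprod, hτ.logTrace_conj (by rw [← star_mul, Units.mul_inv, star_one])
    (by rw [← star_mul, Units.inv_mul, star_one]), e2, Units.val_mul, coe_expUnit] at e1
  have e3 : τ ((2 : ℝ) • s) = (2 : ℝ) • τ s := (τ.restrictScalars ℝ).map_smul _ _
  rw [e3, smul_smul, mul_comm] at e1
  rw [e1]
  ring

/-- Multiplicativity of the Fuglede–Kadison determinant. -/
theorem trace_logAbsSq_mul {τ : M →L[ℂ] ℂ} (hτ : IsTracial τ) (x y : Mˣ) :
    τ (logAbsSq ((x * y : Mˣ) : M)) = τ (logAbsSq (x : M)) + τ (logAbsSq (y : M)) := by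
  set s := logAbs (x : M) with hs
  have hssa : IsSelfAdjoint s := isSelfAdjoint_logAbs _
  -- Subtracting the expected linear growth leaves a locally constant function, which is compared at
  -- t = 1 and t = 0.
  have hloc : IsLocallyConstant fun t : ℝ =>
      τ (logAbsSq (exp (t • s) * (y : M))) - (2 * t) • τ s := by
    rw [IsLocallyConstant.iff_eventually_eq]
    intro t₀
    filter_upwards [eventually_trace_logAbsSq s hssa (expUnit (t₀ • s) * y) t₀ hτ] with t ht
    have e : exp ((t - t₀) • s) * ((expUnit (t₀ • s) * y : Mˣ) : M) = exp (t • s) * (y : M) := by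
      have := congrArg (fun g : Mˣ => (g : M)) (expUnit_add_smul (t - t₀) t₀ s)
      simp only [sub_add_cancel, Units.val_mul, coe_expUnit] at this
      rw [this, Units.val_mul, coe_expUnit, mul_assoc]
    rw [e, Units.val_mul, coe_expUnit] at ht
    rw [ht]
    simp only [Complex.real_smul]
    push_cast
    ring
  have h := hloc.apply_eq_of_preconnectedSpace 1 0
  simp only [one_smul, zero_smul, exp_zero, one_mul, mul_zero, sub_zero, mul_one] at h
  have hx : ((x * y : Mˣ) : M) = (polar x : M) * (exp s * y) := by
    conv_lhs => rw [← polar_mul_expUnit x]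
    simp only [Units.val_mul, coe_expUnit, mul_assoc]
    rfl
  have h2 : (2 : ℝ) • τ s = τ (logAbsSq (x : M)) := by
    have e : τ ((2 : ℝ) • s) = (2 : ℝ) • τ s := (τ.restrictScalars ℝ).map_smul _ _
    rw [← e, hs, logAbs, smul_smul]
    norm_num
  rw [hx, logAbsSq_unitary_mul, ← h2, ← h]
  ring

end Determinant

end Polar

/-! ### Matrix algebras: compatibility with padding, and traces. -/

section MatrixAlgebras

variable {A B : Type*} [CStarAlgebra A] [CStarAlgebra B]

/-- `M_n(B)` with its C⋆-norm. -/
abbrev MatC (n : ℕ) (B : Type*) : Type _ := CStarMatrix (Fin n) (Fin n) B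

/-! ### Padding by zero -/

/-- The map `x ↦ x ⊕ 0`. -/
def padZero {n m : ℕ} (h : n ≤ m) (x : Matrix (Fin n) (Fin n) B) : Matrix (Fin m) (Fin m) B :=
  pad h x - pad h 0

theorem padZero_apply {n m : ℕ} (h : n ≤ m) (x : Matrix (Fin n) (Fin n) B) (i j : Fin m) :
    padZero h x i j = if hij : (i : ℕ) < n ∧ (j : ℕ) < n then x ⟨i, hij.1⟩ ⟨j, hij.2⟩ else 0 := by
  simp only [padZero, Matrix.sub_apply, pad_apply]
  split_ifs <;> simp

theorem padZero_real_smul {n m : ℕ} (h : n ≤ m) (r : ℝ) (x : Matrix (Fin n) (Fin n) B) :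
    padZero h (r • x) = r • padZero h x := by
  ext i j
  simp only [padZero_apply, Matrix.smul_apply]
  split_ifs <;> simp

theorem star_padZero {n m : ℕ} (h : n ≤ m) (x : Matrix (Fin n) (Fin n) B) :
    star (padZero h x) = padZero h (star x) := by
  rw [padZero, star_sub, ← map_star, ← map_star, star_zero, padZero]

/-- The unital homomorphism `(x, c) ↦ x ⊕ c`. -/
def padScalar {n m : ℕ} (h : n ≤ m) :
    Matrix (Fin n) (Fin n) B × ℂ →+* Matrix (Fin m) (Fin m) B where
  toFun p := pad h p.1 - pad h 0 + p.2 • pad h 0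
  map_one' := by simp
  map_zero' := by simp
  map_mul' p p' := by
    have h1 : ∀ x y : Matrix (Fin n) (Fin n) B, pad h x * pad h y = pad h (x * y) :=
      fun x y => (map_mul _ _ _).symm
    simp only [Prod.fst_mul, Prod.snd_mul, sub_mul, mul_sub, add_mul, mul_add, h1, mul_zero,
      zero_mul, smul_mul_assoc, mul_smul_comm, mul_smul, sub_self, zero_add]
    rw [smul_comm p'.2 p.2]
    abel
  map_add' p p' := by
    ext i j
    simp only [Prod.fst_add, Prod.snd_add, Matrix.add_apply, Matrix.sub_apply, Matrix.smul_apply,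
      pad_apply, Matrix.zero_apply, add_smul]
    split_ifs <;> simp

/-- `x ↦ x ⊕ 0` on the C⋆-algebras of matrices. -/
def padZeroC {n m : ℕ} (h : n ≤ m) (x : MatC n B) : MatC m B :=
  CStarMatrix.ofMatrix (padZero h (CStarMatrix.ofMatrix.symm x))

theorem isSelfAdjoint_padZeroC {n m : ℕ} (h : n ≤ m) {x : MatC n B} (hx : IsSelfAdjoint x) :
    IsSelfAdjoint (padZeroC h x) :=
  (star_padZero h (CStarMatrix.ofMatrix.symm x)).trans (congrArg (padZeroC h) hx)

/-- exp(x) ⊕ 1 = exp(x ⊕ 0): the continuous unital homomorphism (x, c) ↦ x ⊕ c commutes with exp and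
is evaluated at (x, 0). In the code 0 ⊕ 1 is `pad h 0`. -/
theorem pad_exp {n m : ℕ} (h : n ≤ m) (x : MatC n B) :
    CStarMatrix.ofMatrix (pad h (CStarMatrix.ofMatrix.symm (exp x))) = exp (padZeroC h x) := by
  let Φ : MatC n B × ℂ →+* MatC m B := padScalar (B := B) h
  have hc : Continuous Φ := by
    have h1 : Continuous fun p : Matrix (Fin n) (Fin n) B × ℂ =>
        pad h p.1 - pad h (0 : Matrix (Fin n) (Fin n) B) + p.2 • pad h 0 :=
      (((continuous_pad h).comp continuous_fst).sub continuous_const).add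
        (continuous_snd.smul continuous_const)
    exact h1
  let _ : NormedAlgebra ℚ (MatC n B × ℂ) := Prod.normedAlgebra ℚ
  have h1 := map_exp Φ hc (x, 0)
  have h2 : exp ((x, 0) : MatC n B × ℂ) = (exp x, 1) := by
    ext1
    · rw [Prod.fst_exp]
    · rw [Prod.snd_exp]; simp
  have e : ∀ (y : Matrix (Fin n) (Fin n) B) (c : ℂ),
      padScalar h (y, c) = padZero h y + c • pad h 0 := fun y c => rfl
  have h3 : Φ (x, 0) = padZeroC h x :=
    (e (CStarMatrix.ofMatrix.symm x) 0).trans (by rw [zero_smul, add_zero]; rfl)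
  have h4 : Φ (exp x, 1) = CStarMatrix.ofMatrix (pad h (CStarMatrix.ofMatrix.symm (exp x))) :=
    (e (CStarMatrix.ofMatrix.symm (exp x)) 1).trans (by
      rw [one_smul, padZero, sub_add_cancel]; rfl)
  rw [h2, h3, h4] at h1
  exact h1

/-! ### Polar decomposition in `GL_n(B)` -/

/-- The logarithm of `x⋆ x` for `x` in `GL_n(B)`. -/
noncomputable def logAbsSqGL (n : ℕ) (x : GLn B n) : MatC n B :=
  logAbsSq (CStarMatrix.ofMatrix (x : Matrix (Fin n) (Fin n) B))

/-- The statement for a general C⋆-algebra applies as it stands, since `MatC n B` has by definition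
the ring structure and involution of the matrix ring. -/
theorem exp_logAbsSqGL (n : ℕ) (x : GLn B n) : exp (logAbsSqGL n x) =
    CStarMatrix.ofMatrix (star (x : Matrix (Fin n) (Fin n) B) * (x : Matrix (Fin n) (Fin n) B)) :=
  exp_logAbsSq (M := MatC n B) x

theorem isSelfAdjoint_logAbsSqGL (n : ℕ) (x : GLn B n) : IsSelfAdjoint (logAbsSqGL n x) :=
  isSelfAdjoint_logAbsSq _

theorem continuous_logAbsSqGL (n : ℕ) : Continuous (logAbsSqGL n : GLn B n → MatC n B) :=
  continuous_logAbsSq (M := MatC n B)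

/-- Both sides are selfadjoint with the same exponential. Passing from x to x ⊕ 1 pads the logarithm
by 0, so its trace is unchanged and the determinant descends to the limit. -/
theorem logAbsSqGL_padGL {n m : ℕ} (h : n ≤ m) (x : GLn B n) :
    logAbsSqGL m (padGL B n m h x) = padZeroC h (logAbsSqGL n x) := by
  have h1 : exp (logAbsSqGL m (padGL B n m h x)) = exp (padZeroC h (logAbsSqGL n x)) := by
    rw [exp_logAbsSqGL, ← pad_exp, exp_logAbsSqGL, Equiv.symm_apply_apply]
    have e : star (pad h (x : Matrix (Fin n) (Fin n) B)) * pad h (x : Matrix (Fin n) (Fin n) B)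
        = pad h (star (x : Matrix (Fin n) (Fin n) B) * (x : Matrix (Fin n) (Fin n) B)) := by
      rw [map_mul, map_star]
    exact congrArg CStarMatrix.ofMatrix e
  rw [← CFC.log_exp (logAbsSqGL m (padGL B n m h x)) (isSelfAdjoint_logAbsSqGL m _), h1,
    CFC.log_exp _ (isSelfAdjoint_padZeroC h (isSelfAdjoint_logAbsSqGL n x))]

/-- The unitary part of an element of `GL_n(B)`. -/
noncomputable def polarGL (n : ℕ) (x : GLn B n) : Un B n := polar (M := MatC n B) x

theorem continuous_polarGL (n : ℕ) : Continuous (polarGL n : GLn B n → Un B n) :=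
  continuous_polar (M := MatC n B)

theorem polarGL_toUnits (n : ℕ) (u : Un B n) : polarGL n (Unitary.toUnits u) = u :=
  polar_toUnits (M := MatC n B) u

theorem map_polarGL_mul {Q : Type*} [CommGroup Q] {n : ℕ} {q : Un B n →* Q}
    (hq : IsClosed (q.ker : Set (Un B n))) (x y : GLn B n) :
    q (polarGL n (x * y)) = q (polarGL n x) * q (polarGL n y) :=
  map_polar_mul (M := MatC n B) hq x y

theorem coe_polarGL (n : ℕ) (x : GLn B n) : (polarGL n x : Matrix (Fin n) (Fin n) B) =
    x * CStarMatrix.ofMatrix.symm (exp (-((1 / 2 : ℝ) • logAbsSqGL n x))) := rfl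

theorem polarGL_padGL {n m : ℕ} (h : n ≤ m) (x : GLn B n) :
    polarGL m (padGL B n m h x) = padU B n m h (polarGL n x) := by
  apply Subtype.ext
  have h1 : ((padU B n m h (polarGL n x) : Un B m) : Matrix (Fin m) (Fin m) B)
      = pad h (polarGL n x : Matrix (Fin n) (Fin n) B) := rfl
  have h2 : ((padGL B n m h x : GLn B m) : Matrix (Fin m) (Fin m) B) = pad h x := rfl
  have h3 : padZeroC h ((-(1 / 2) : ℝ) • logAbsSqGL n x)
      = (-(1 / 2) : ℝ) • padZeroC h (logAbsSqGL n x) :=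
    padZero_real_smul h _ (CStarMatrix.ofMatrix.symm (logAbsSqGL n x))
  rw [h1, coe_polarGL, coe_polarGL, map_mul, h2, logAbsSqGL_padGL, ← neg_smul, ← neg_smul, ← h3,
    ← pad_exp, Equiv.symm_apply_apply]

/-- The exponential as an element of `GL_n(B)`. -/
noncomputable def expGL (n : ℕ) (x : MatC n B) : GLn B n := expUnit (M := MatC n B) x

theorem polarGL_mul_expGL (n : ℕ) (x : GLn B n) :
    Unitary.toUnits (polarGL n x) * expGL n ((1 / 2 : ℝ) • logAbsSqGL n x) = x :=
  polar_mul_expUnit (M := MatC n B) x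

/-- Entrywise application of `φ` on the C⋆-algebras of matrices. -/
def mapC (φ : A →⋆ₐ[ℂ] B) (n : ℕ) (x : MatC n A) : MatC n B :=
  CStarMatrix.ofMatrix (matrixMap φ n (CStarMatrix.ofMatrix.symm x))

theorem mapC_apply (φ : A →⋆ₐ[ℂ] B) (n : ℕ) (x : MatC n A) (i j : Fin n) :
    mapC φ n x i j = φ (x i j) := rfl

theorem mapGL_expGL (φ : A →⋆ₐ[ℂ] B) (n : ℕ) (x : MatC n A) :
    mapGL φ n (expGL n x) = expGL n (mapC φ n x) := by
  apply Units.ext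
  let Φ : MatC n A →+* MatC n B :=
    (φ : A →+* B).mapMatrix (m := Fin n)
  have hc : Continuous Φ := continuous_matrixMap φ n
  exact map_exp Φ hc x

theorem map_expGL_eq_of_forall_trace {Q : Type*} [CommGroup Q] {n : ℕ} {q : GLn B n →* Q}
    (hq : IsClosed (q.ker : Set (GLn B n))) {h k : MatC n B} (hh : IsSelfAdjoint h)
    (hk : IsSelfAdjoint k)
    (htr : ∀ τ : MatC n B →L[ℂ] ℂ, IsPositiveTrace τ → τ h = τ k) :
    q (expGL n h) = q (expGL n k) :=
  map_expUnit_eq_of_forall_trace (M := MatC n B) hq hh hk htr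

/-! ### Traces on matrix algebras -/

/-- The trace on `M_n(B)` induced by a functional on `B`. -/
noncomputable def matrixTrace (n : ℕ) (τ : B →L[ℂ] ℂ) : MatC n B →L[ℂ] ℂ where
  toFun x := ∑ i, τ (x i i)
  map_add' x y := by
    simp [Finset.sum_add_distrib]
  map_smul' c x := by
    simp [Finset.mul_sum]
  cont := by
    refine continuous_finsetSum _ fun i _ => τ.continuous.comp ?_
    exact (continuous_apply i).comp (continuous_apply (A := fun _ : Fin n => Fin n → B) i)

theorem matrixTrace_apply (n : ℕ) (τ : B →L[ℂ] ℂ) (x : MatC n B) :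
    matrixTrace n τ x = ∑ i, τ (x i i) := rfl

theorem isTracial_matrixTrace (n : ℕ) {τ : B →L[ℂ] ℂ} (hτ : IsTracial τ) :
    IsTracial (matrixTrace n τ) := by
  intro a b
  simp only [matrixTrace_apply, CStarMatrix.mul_apply, map_sum]
  rw [Finset.sum_comm]
  exact Finset.sum_congr rfl fun i _ => Finset.sum_congr rfl fun j _ => hτ _ _

theorem matrixTrace_padZeroC {n m : ℕ} (h : n ≤ m) (τ : B →L[ℂ] ℂ) (x : MatC n B) :
    matrixTrace m τ (padZeroC h x) = matrixTrace n τ x := by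
  obtain ⟨d, rfl⟩ := Nat.exists_eq_add_of_le h
  have e : ∀ i j, padZeroC h x i j = padZero h (CStarMatrix.ofMatrix.symm x) i j :=
    fun i j => rfl
  simp only [matrixTrace_apply, e, padZero_apply, Fin.sum_univ_add]
  simp

/-- The matrix with entry `b` at `(i, j)`. -/
def singleC {n : ℕ} (i j : Fin n) (b : B) : MatC n B := CStarMatrix.ofMatrix (Matrix.single i j b)

theorem singleC_mul_same {n : ℕ} (i j k : Fin n) (b c : B) :
    singleC i j b * singleC j k c = singleC i k (b * c) :=
  Matrix.single_mul_single_same b i j k c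

theorem singleC_mul_of_ne {n : ℕ} (i : Fin n) {j k : Fin n} (l : Fin n) (h : j ≠ k) (b c : B) :
    singleC i j b * singleC k l c = 0 :=
  Matrix.single_mul_single_of_ne b i j k h c

theorem star_singleC {n : ℕ} (i j : Fin n) (b : B) :
    star (singleC i j b) = singleC j i (star b) :=
  Matrix.conjTranspose_single i j b

/-- The entry functional `b ↦ σ (b e_{ij})`. -/
noncomputable def entryFunctional {n : ℕ} (σ : MatC n B →L[ℂ] ℂ) (i j : Fin n) : B →L[ℂ] ℂ where
  toFun b := σ (singleC i j b)
  map_add' b b' := (congrArg σ (Matrix.single_add i j b b')).trans (map_add σ _ _)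
  map_smul' c b := (congrArg σ (Matrix.smul_single c i j b).symm).trans (map_smul σ _ _)
  cont := by
    have h : Continuous fun b : B => Matrix.single i j b := by
      refine continuous_matrix fun k l => ?_
      simp only [Matrix.single_apply]
      split_ifs
      · exact continuous_id
      · exact continuous_const
    exact σ.continuous.comp h

theorem entryFunctional_apply {n : ℕ} (σ : MatC n B →L[ℂ] ℂ) (i j : Fin n) (b : B) :
    entryFunctional σ i j b = σ (singleC i j b) := rfl

theorem apply_eq_sum_entryFunctional {n : ℕ} (σ : MatC n B →L[ℂ] ℂ) (x : MatC n B) :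
    σ x = ∑ i, ∑ j, entryFunctional σ i j (x i j) := by
  have h : x = ∑ i, ∑ j, singleC i j (x i j) :=
    Matrix.matrix_eq_sum_single (CStarMatrix.ofMatrix.symm x)
  conv_lhs => rw [h]
  simp only [map_sum]
  rfl

theorem IsPositiveTrace.entryFunctional_self {n : ℕ} {σ : MatC n B →L[ℂ] ℂ}
    (hσ : IsPositiveTrace σ) (i : Fin n) : IsPositiveTrace (entryFunctional σ i i) := by
  constructor
  · intro b
    rw [entryFunctional_apply, ← singleC_mul_same i i i, ← star_singleC]
    exact hσ.1 _
  · intro a b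
    rw [entryFunctional_apply, entryFunctional_apply, ← singleC_mul_same i i i, hσ.2,
      singleC_mul_same]

theorem IsTracial.entryFunctional_of_ne {n : ℕ} {σ : MatC n B →L[ℂ] ℂ}
    (hσ : IsTracial σ) {i j : Fin n} (hij : i ≠ j) (b : B) : entryFunctional σ i j b = 0 := by
  rw [entryFunctional_apply, ← mul_one b, ← singleC_mul_same i i j, hσ,
    singleC_mul_of_ne _ _ hij.symm, map_zero]

/-- A positive trace on M_n(B) vanishes on off-diagonal matrix units and restricts to positive
traces of B on the diagonal ones, so agreement on the traces of B suffices. -/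
theorem IsPositiveTrace.apply_mapC_eq {φ ψ : A →⋆ₐ[ℂ] B}
    (h : ∀ τ : B →L[ℂ] ℂ, IsPositiveTrace τ → ∀ a, τ (φ a) = τ (ψ a)) {n : ℕ}
    {σ : MatC n B →L[ℂ] ℂ} (hσ : IsPositiveTrace σ) (x : MatC n A) :
    σ (mapC φ n x) = σ (mapC ψ n x) := by
  rw [apply_eq_sum_entryFunctional, apply_eq_sum_entryFunctional σ (mapC ψ n x)]
  refine Finset.sum_congr rfl fun i _ => Finset.sum_congr rfl fun j _ => ?_
  rw [mapC_apply, mapC_apply]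
  rcases eq_or_ne i j with rfl | hij
  · exact h _ (hσ.entryFunctional_self i) (x i i)
  · rw [hσ.2.entryFunctional_of_ne hij, hσ.2.entryFunctional_of_ne hij]

theorem isSelfAdjoint_mapC (φ : A →⋆ₐ[ℂ] B) {n : ℕ} {x : MatC n A} (hx : IsSelfAdjoint x) :
    IsSelfAdjoint (mapC φ n x) :=
  (map_star (matrixMap φ n) (CStarMatrix.ofMatrix.symm x)).symm.trans (congrArg (mapC φ n) hx)

/-! ### Tracial states and positive traces -/

theorem IsPositiveTrace.apply_nonneg {σ : B →L[ℂ] ℂ} (hσ : IsPositiveTrace σ) {b : B}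
    (hb : 0 ≤ b) : 0 ≤ σ b := by
  obtain ⟨c, rfl⟩ := CStarAlgebra.nonneg_iff_eq_star_mul_self.1 hb
  exact hσ.1 c

/-- For positive b one has 0 ≤ b ≤ ‖b‖·1, and the positive elements span B. -/
theorem IsPositiveTrace.eq_zero_of_apply_one {σ : B →L[ℂ] ℂ} (hσ : IsPositiveTrace σ)
    (h1 : σ 1 = 0) (b : B) : σ b = 0 := by
  have hb : b ∈ Submodule.span ℂ {a : B | 0 ≤ a} := by
    rw [CStarAlgebra.span_nonneg]; trivial
  induction hb using Submodule.span_induction with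
  | mem b hb =>
    have h2 := hσ.apply_nonneg (sub_nonneg.2 (IsSelfAdjoint.le_algebraMap_norm_self
      (a := b) (IsSelfAdjoint.of_nonneg hb)))
    have h3 : σ (algebraMap ℝ B ‖b‖) = 0 := by
      rw [Algebra.algebraMap_eq_smul_one]
      have : σ (‖b‖ • (1 : B)) = ‖b‖ • σ 1 := (σ.restrictScalars ℝ).map_smul _ _
      rw [this, h1, smul_zero]
    rw [map_sub, h3, zero_sub, neg_nonneg] at h2
    exact le_antisymm h2 (hσ.apply_nonneg hb)
  | zero => simp
  | add x y _ _ hx hy => rw [map_add, hx, hy, add_zero]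
  | smul c x _ hx => rw [map_smul, hx, smul_zero]

/-- A positive trace is either zero or a multiple of a tracial state. -/
theorem tracialStatesMap_eq_iff {φ ψ : A →⋆ₐ[ℂ] B} :
    tracialStatesMap φ = tracialStatesMap ψ ↔
      ∀ τ : B →L[ℂ] ℂ, IsPositiveTrace τ → ∀ a, τ (φ a) = τ (ψ a) := by
  constructor
  · intro h τ hτ a
    by_cases h1 : τ 1 = 0
    · rw [hτ.eq_zero_of_apply_one h1, hτ.eq_zero_of_apply_one h1]
    · have hpos : 0 ≤ τ 1 := hτ.apply_nonneg zero_le_one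
      have hmem : StrongDual.toWeakDual ((τ 1)⁻¹ • τ) ∈ tracialStates B := by
        refine ⟨fun b => ?_, ?_, fun b c => ?_⟩
        · change 0 ≤ (τ 1)⁻¹ * τ (star b * b)
          exact mul_nonneg (inv_nonneg.2 hpos) (hτ.1 b)
        · exact inv_mul_cancel₀ h1
        · change (τ 1)⁻¹ * τ (b * c) = (τ 1)⁻¹ * τ (c * b)
          rw [hτ.2]
      have h2 := congrArg (fun ρ : tracialStates A => ρ.1 a) (congrFun h ⟨_, hmem⟩)
      have h3 : (τ 1)⁻¹ * τ (φ a) = (τ 1)⁻¹ * τ (ψ a) := h2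
      exact mul_left_cancel₀ (inv_ne_zero h1) h3
  · intro h
    funext τ
    apply Subtype.ext
    apply DFunLike.ext
    intro a
    exact h (WeakDual.toStrongDual τ.1) ⟨τ.2.1, τ.2.2.2⟩ a

end MatrixAlgebras

/-! ### Hausdorffized abelianizations. -/

section Quotients

variable {G : Type*} [Group G] [TopologicalSpace G] [SeparatelyContinuousMul G] [ContinuousInv G]

theorem isClosed_closedCommutator : IsClosed (closedCommutator G : Set G) :=
  isClosed_closure (s := (commutator G : Set G))

theorem closedCommutator_le_ker {Q : Type*} [CommGroup Q] {f : G →* Q}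
    (hf : IsClosed (f.ker : Set G)) : closedCommutator G ≤ f.ker :=
  closure_minimal (Abelianization.commutator_subset_ker f) hf

/-- The Hausdorffized abelianization is commutative. -/
@[reducible] def commGroupHausdorffAbelianization : CommGroup (HausdorffAbelianization G) :=
  { (inferInstance : Group (HausdorffAbelianization G)) with
    mul_comm :=
      (Subgroup.Normal.quotient_commutative_iff_commutator_le.2
        (subset_closure (s := (commutator G : Set G)))).is_comm.comm }

attribute [local instance] commGroupHausdorffAbelianization

theorem isClosed_ker_comp_mk {H : Type*} [Group H] [TopologicalSpace H] {f : H →* G}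
    (hf : Continuous f) :
    IsClosed (((QuotientGroup.mk' (closedCommutator G)).comp f).ker : Set H) := by
  have h : (((QuotientGroup.mk' (closedCommutator G)).comp f).ker : Set H)
      = f ⁻¹' (closedCommutator G : Set G) := by
    ext x
    simp [MonoidHom.mem_ker]
  rw [h]
  exact isClosed_closedCommutator.preimage hf

/-- The preimage of a point is a translate of the closed subgroup CG; separate continuity of the
multiplication is enough for it to be closed. -/
instance t1Space_hausdorffAbelianization : T1Space (HausdorffAbelianization G) where
  t1 x := by
    obtain ⟨g, rfl⟩ := QuotientGroup.mk_surjective x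
    refine isClosed_coinduced.2 ?_
    have h : (QuotientGroup.mk (s := closedCommutator G)) ⁻¹' {(g : HausdorffAbelianization G)}
        = (fun y => g⁻¹ * y) ⁻¹' (closedCommutator G : Set G) := by
      ext y
      rw [mem_preimage, mem_singleton_iff, eq_comm, QuotientGroup.eq]
      rfl
    exact h ▸ isClosed_closedCommutator.preimage
      (SeparatelyContinuousMul.continuous_const_mul (a := g⁻¹))

/-- A continuous homomorphism to a commutative T₁ group factors through the Hausdorffized
abelianization. -/
theorem apply_eq_of_mk_eq {Q : Type*} [CommGroup Q] [TopologicalSpace Q] [T1Space Q] {f : G →* Q}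
    (hf : Continuous f) {x y : G} (h : (x : HausdorffAbelianization G) = y) : f x = f y := by
  have h1 := closedCommutator_le_ker (f := f) (isClosed_singleton.preimage hf)
    (QuotientGroup.eq.1 h)
  rwa [MonoidHom.mem_ker, map_mul, map_inv, inv_mul_eq_one] at h1

end Quotients

attribute [local instance] commGroupHausdorffAbelianization

/-! ### Homomorphisms into and out of the inductive limit. -/

section Limits

variable {G : ℕ → Type*} [∀ n, Group (G n)] {f : ∀ i j, i ≤ j → G i →* G j}
  [DirectedSystem G (f · · ·)]

/-- The canonical homomorphism from a member of a directed system to the limit. -/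
noncomputable def limitOf (f : ∀ i j, i ≤ j → G i →* G j) [DirectedSystem G (f · · ·)] (n : ℕ) :
    G n →* DirectLimit G f :=
  MonoidHom.mk' (fun x => ⟦⟨n, x⟩⟧) fun x y => (DirectLimit.mul_def n x y).symm

theorem limitOf_map {n m : ℕ} (h : n ≤ m) (x : G n) : limitOf f m (f n m h x) = limitOf f n x :=
  (Quotient.sound ⟨m, h, le_rfl, by
    rw [DirectedSystem.map_self' f]⟩ : (⟦⟨n, x⟩⟧ : DirectLimit G f) = ⟦⟨m, f n m h x⟩⟧).symm

/-- The homomorphism from the limit given by a compatible family of homomorphisms. -/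
noncomputable def limitLift {Q : Type*} [Group Q] (F : ∀ n, G n → Q)
    (hmul : ∀ n x y, F n (x * y) = F n x * F n y)
    (hF : ∀ n m h x, F n x = F m (f n m h x)) : DirectLimit G f →* Q :=
  MonoidHom.mk' (DirectLimit.lift f F hF) fun a b => by
    induction a, b using DirectLimit.induction₂ with
    | ih i x y => simp only [DirectLimit.mul_def, DirectLimit.lift_def, hmul]

theorem continuous_limitOf [∀ n, TopologicalSpace (G n)] (n : ℕ) : Continuous (limitOf f n) :=
  continuous_mk f n

end Limits

/-! ### Passage to the limit and the two implications. -/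

section MainTheorem

variable {A B : Type*} [CStarAlgebra A] [CStarAlgebra B]

/-- The class in `GL_∞(B) / CGL_∞(B)` of an element of `GL_n(B)`. -/
noncomputable def classGL (B : Type*) [CStarAlgebra B] (n : ℕ) : GLn B n →* HausdorffK1Alg B :=
  (QuotientGroup.mk' (closedCommutator (GLInf B))).comp (limitOf (padGL B) n)

/-- The class in `U_∞(B) / CU_∞(B)` of an element of `U_n(B)`. -/
noncomputable def classU (B : Type*) [CStarAlgebra B] (n : ℕ) : Un B n →* HausdorffK1AlgU B :=
  (QuotientGroup.mk' (closedCommutator (UInf B))).comp (limitOf (padU B) n)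

theorem isClosed_ker_classGL (n : ℕ) : IsClosed ((classGL B n).ker : Set (GLn B n)) :=
  isClosed_ker_comp_mk (continuous_limitOf n)

theorem isClosed_ker_classU (n : ℕ) : IsClosed ((classU B n).ker : Set (Un B n)) :=
  isClosed_ker_comp_mk (continuous_limitOf n)

theorem hausdorffK1AlgMap_eq_iff {φ ψ : A →⋆ₐ[ℂ] B} :
    hausdorffK1AlgMap φ = hausdorffK1AlgMap ψ ↔
      ∀ n x, classGL B n (mapGL φ n x) = classGL B n (mapGL ψ n x) := by
  refine ⟨fun h n x => DFunLike.congr_fun h (classGL A n x), fun h => ?_⟩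
  refine QuotientGroup.monoidHom_ext _ (MonoidHom.ext fun a => ?_)
  induction a using DirectLimit.induction with
  | ih n x => exact h n x

theorem hausdorffK1AlgUMap_eq_iff {φ ψ : A →⋆ₐ[ℂ] B} :
    hausdorffK1AlgUMap φ = hausdorffK1AlgUMap ψ ↔
      ∀ n x, classU B n (mapU φ n x) = classU B n (mapU ψ n x) := by
  refine ⟨fun h n x => DFunLike.congr_fun h (classU A n x), fun h => ?_⟩
  refine QuotientGroup.monoidHom_ext _ (MonoidHom.ext fun a => ?_)
  induction a using DirectLimit.induction with
  | ih n x => exact h n x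

/-- The inclusion `U_∞(B) → GL_∞(B)`. -/
noncomputable def inclusionInf (B : Type*) [CStarAlgebra B] : UInf B →* GLInf B :=
  limitMap (fun _ => Unitary.toUnits) fun _ _ _ _ => Units.ext rfl

theorem continuous_inclusionInf : Continuous (inclusionInf B) :=
  continuous_limitMap _ _ fun n => continuous_toUnits (M := MatC n B)

theorem classGL_toUnits_eq {n : ℕ} {u v : Un B n} (h : classU B n u = classU B n v) :
    classGL B n (Unitary.toUnits u) = classGL B n (Unitary.toUnits v) :=
  congrArg (HausdorffAbelianization.map (inclusionInf B) continuous_inclusionInf) h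

theorem mapGL_toUnits (φ : A →⋆ₐ[ℂ] B) (n : ℕ) (u : Un A n) :
    mapGL φ n (Unitary.toUnits u) = Unitary.toUnits (mapU φ n u) := Units.ext rfl

/-- The homomorphism `GL_∞(B) → U_∞(B) / CU_∞(B)` given by the polar decomposition. -/
noncomputable def polarInf (B : Type*) [CStarAlgebra B] : GLInf B →* HausdorffK1AlgU B :=
  limitLift (fun n x => classU B n (polarGL n x))
    (fun n x y => map_polarGL_mul (isClosed_ker_classU n) x y) fun n m h x => by
      rw [polarGL_padGL]
      exact congrArg _ (limitOf_map h (polarGL n x)).symm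

theorem continuous_polarInf : Continuous (polarInf B) :=
  continuous_of_comp_mk fun n => continuous_quotient_mk'.comp
    ((continuous_limitOf (f := padU B) n).comp (continuous_polarGL n))

/-- The logarithm of the Fuglede–Kadison determinant on `GL_∞(B)`. -/
noncomputable def logDetInf {τ : B →L[ℂ] ℂ} (hτ : IsTracial τ) :
    GLInf B →* Multiplicative ℂ :=
  limitLift (fun n x => Multiplicative.ofAdd (matrixTrace n τ (logAbsSqGL n x)))
    (fun n x y => congrArg Multiplicative.ofAdd
      (trace_logAbsSq_mul (M := MatC n B) (isTracial_matrixTrace n hτ) x y))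
    fun n m h x => by rw [logAbsSqGL_padGL, matrixTrace_padZeroC]

theorem continuous_logDetInf {τ : B →L[ℂ] ℂ} (hτ : IsTracial τ) : Continuous (logDetInf hτ) :=
  continuous_of_comp_mk fun n => continuous_ofAdd.comp
    ((matrixTrace n τ).continuous.comp (continuous_logAbsSqGL n))

/-- `polarInf` factors through GL_∞/CGL_∞, and a unitary is its own unitary part, so the map from
U_∞/CU_∞ is injective. -/
theorem classU_eq_of_classGL_eq {n : ℕ} {u v : Un B n}
    (h : classGL B n (Unitary.toUnits u) = classGL B n (Unitary.toUnits v)) :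
    classU B n u = classU B n v := by
  have h1 : classU B n (polarGL n (Unitary.toUnits u))
      = classU B n (polarGL n (Unitary.toUnits v)) := apply_eq_of_mk_eq continuous_polarInf h
  rwa [polarGL_toUnits, polarGL_toUnits] at h1

theorem logAbsSqGL_expGL (n : ℕ) {x : MatC n B} (hx : IsSelfAdjoint x) :
    logAbsSqGL n (expGL n x) = (2 : ℝ) • x := logAbsSq_exp hx

/-- The determinant `logDetInf` factors through GL_∞/CGL_∞ and takes exp(x) to twice the trace of x.
-/
theorem matrixTrace_eq_of_classGL_eq {τ : B →L[ℂ] ℂ} (hτ : IsTracial τ) {n : ℕ} {x y : MatC n B}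
    (hx : IsSelfAdjoint x) (hy : IsSelfAdjoint y)
    (h : classGL B n (expGL n x) = classGL B n (expGL n y)) :
    matrixTrace n τ x = matrixTrace n τ y := by
  have h1 : matrixTrace n τ (logAbsSqGL n (expGL n x)) =
      matrixTrace n τ (logAbsSqGL n (expGL n y)) :=
    apply_eq_of_mk_eq (continuous_logDetInf hτ) h
  have e : ∀ z, matrixTrace n τ ((2 : ℝ) • z) = (2 : ℝ) • matrixTrace n τ z :=
    fun z => ((matrixTrace n τ).restrictScalars ℝ).map_smul _ _
  rw [logAbsSqGL_expGL n hx, logAbsSqGL_expGL n hy, e, e] at h1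
  exact smul_right_injective ℂ (two_ne_zero (α := ℝ)) h1

theorem hausdorffK1AlgMap_eq_of {φ ψ : A →⋆ₐ[ℂ] B}
    (hU : hausdorffK1AlgUMap φ = hausdorffK1AlgUMap ψ)
    (hT : tracialStatesMap φ = tracialStatesMap ψ) :
    hausdorffK1AlgMap φ = hausdorffK1AlgMap ψ := by
  rw [hausdorffK1AlgUMap_eq_iff] at hU
  rw [tracialStatesMap_eq_iff] at hT
  rw [hausdorffK1AlgMap_eq_iff]
  intro n x
  set s : MatC n A := (1 / 2 : ℝ) • logAbsSqGL n x
  have hs : IsSelfAdjoint s := (IsSelfAdjoint.all _).smul (isSelfAdjoint_logAbsSqGL n x)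
  have h1 : classGL B n (expGL n (mapC φ n s)) = classGL B n (expGL n (mapC ψ n s)) :=
    map_expGL_eq_of_forall_trace (isClosed_ker_classGL n) (isSelfAdjoint_mapC φ hs)
      (isSelfAdjoint_mapC ψ hs) fun τ hτ => hτ.apply_mapC_eq hT s
  rw [← polarGL_mul_expGL n x, map_mul (mapGL φ n), map_mul (mapGL ψ n), mapGL_toUnits,
    mapGL_toUnits, mapGL_expGL, mapGL_expGL, map_mul, map_mul, classGL_toUnits_eq (hU n (polarGL n x)), h1]

theorem apply_eq_of_hausdorffK1AlgMap_eq {φ ψ : A →⋆ₐ[ℂ] B}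
    (h : hausdorffK1AlgMap φ = hausdorffK1AlgMap ψ) {τ : B →L[ℂ] ℂ} (hτ : IsTracial τ) (a : A) :
    τ (φ a) = τ (ψ a) := by
  rw [hausdorffK1AlgMap_eq_iff] at h
  have key : ∀ b : A, IsSelfAdjoint b → τ (φ b) = τ (ψ b) := by
    intro b hb
    -- Exponentials of 1 × 1 matrices already detect τ ∘ φ on selfadjoint elements; real and
    -- imaginary parts give the rest.
    let x : MatC 1 A := CStarMatrix.ofMatrix (Matrix.of fun _ _ => b)
    have hx : IsSelfAdjoint x := by
      ext i j
      exact hb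
    have h1 := h 1 (expGL 1 x)
    rw [mapGL_expGL, mapGL_expGL] at h1
    have h2 := matrixTrace_eq_of_classGL_eq hτ (isSelfAdjoint_mapC φ hx)
      (isSelfAdjoint_mapC ψ hx) h1
    simp only [matrixTrace_apply, Finset.univ_unique, Finset.sum_singleton, mapC_apply] at h2
    exact h2
  rw [← realPart_add_I_smul_imaginaryPart a]
  simp only [map_add, map_smul, key _ (realPart a).2, key _ (imaginaryPart a).2]

end MainTheorem

end HausdorffK1

theorem mainTheorem6 {A B : Type*} [CStarAlgebra A] [CStarAlgebra B] (φ ψ : A →⋆ₐ[ℂ] B) :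
    (HausdorffK1.hausdorffK1AlgUMap φ = HausdorffK1.hausdorffK1AlgUMap ψ ∧
        HausdorffK1.tracialStatesMap φ = HausdorffK1.tracialStatesMap ψ) ↔
      HausdorffK1.hausdorffK1AlgMap φ = HausdorffK1.hausdorffK1AlgMap ψ := by
  refine ⟨fun h => HausdorffK1.hausdorffK1AlgMap_eq_of h.1 h.2, fun h => ⟨?_, ?_⟩⟩
  · rw [HausdorffK1.hausdorffK1AlgUMap_eq_iff]
    intro n u
    refine HausdorffK1.classU_eq_of_classGL_eq ?_
    rw [← HausdorffK1.mapGL_toUnits, ← HausdorffK1.mapGL_toUnits]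
    exact HausdorffK1.hausdorffK1AlgMap_eq_iff.1 h n _
  · exact HausdorffK1.tracialStatesMap_eq_iff.2 fun τ hτ a =>
      HausdorffK1.apply_eq_of_hausdorffK1AlgMap_eq h hτ.2 a
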